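/- Let $Q(K,L,M)=-K^2L(L-M)^2M+L^3M^3+KL^2M^2(M-L)+K^3(L-M)(L+M)^2$, and let $\gamma_1=K-L+M$, $\gamma_2=-KL+KM-LM$, $\gamma_3=-KLM$ be the elementary symmetric functions of $(K,-L,M)$. For real $K,L,M$ let $N^3(K,L,M)$ denote any smooth simply connected $3$-manifold with a global coframe $\sigma^1,\sigma^2,\sigma^3$ satisfying $$d\sigma^1=(L-K)\,\sigma^2\wedge\sigma^3,\quad d\sigma^2=(M+K)\,\sigma^1\wedge\sigma^3,\quad d\sigma^3=(L-M)\,\sigma^1\wedge\sigma^2,$$ with the Riemannian metric $\sum_a\sigma^a\otimes\sigma^a$. Put $V_k=\{[K:L:M]\in\mathbb P^2(k): Q(K,L,M)=0\}$ for $k=\mathbb C,\mathbb R$; a point of $V_{\mathbb C}$ is singular if all partial derivatives of $Q$ vanish there. Then the following hold. 1. $Q=4\gamma_1\gamma_2\gamma_3-\gamma_2^3-4\gamma_3^2$ as polynomials with integer coefficients. 2. The singular points of $V_{\mathbb C}$ are exactly $[1:0:0]$, $[0:1:0]$, $[0:0:1]$. 3. These points correspond to the flat metrics: for every $(K,L,M)\in\mathbb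 R^3\setminus\{0\}$ a space $N^3(K,L,M)$ exists, and every such space is flat if and only if $[K:L:M]\in\{[1:0:0],[0:1:0],[0:0:1]\}$. 4. There are a lattice $\Gamma\subset\mathbb C$ (so that $\mathbb C/\Gamma$ is a compact Riemann surface of genus one), elliptic functions $L,M,\zeta,w$ with respect to $\Gamma$, and a holomorphic map $F:\mathbb C/\Gamma\to\mathbb P^2(\mathbb C)$ such that $F(z)=[1:L(z):M(z)]$ wherever $L$ and $M$ are both holomorphic, the image of $F$ is $V_{\mathbb C}$, and $F$ is injective over the set of non-singular points of $V_{\mathbb C}$. Moreover, wherever $L,M,\zeta,w$ are all holomorphic, $\zeta\neq0$ and $$w^2=(1+\zeta)(1+3\zeta-5\zeta^2+\zeta^3),$$ $$L=-\frac{(1+\zeta)(1-2\zeta+\zeta^2+w)}{4\zeta},\qquad M=\frac{(1+\zeta)(1-2\zeta+\zeta^2-w)}{4\zeta},$$ $$L-M=-\frac{(1+\zeta)(\zeta-1)^2}{2\zeta},\qquad LM=-\frac{(1+\zeta)^2(\zeta-1)}{2\zeta}.$$ 5. The real curve $V_{\mathbb R}\subset\mathbb P^2(\mathbb R)$ is the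 union of six simple arcs, each joining two of the points $[1:0:0]$, $[0:1:0]$, $[0:0:1]$, exactly two arcs for each of the three pairs; the arcs without their end points avoid the three points and are pairwise disjoint. -/

import Mathlib

open scoped LinearAlgebra.Projectivization ContDiff Manifold

noncomputable section

/-! ### The sextic and its projective curve -/

/-- The sextic `Q(K, L, M)`, with `K = X 0`, `L = X 1`, `M = X 2`. -/
def sexticQ (R : Type*) [CommRing R] : MvPolynomial (Fin 3) R :=
  let K : MvPolynomial (Fin 3) R := MvPolynomial.X 0
  let L : MvPolynomial (Fin 3) R := MvPolynomial.X 1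
  let M : MvPolynomial (Fin 3) R := MvPolynomial.X 2;
  -(K ^ 2 * L * (L - M) ^ 2 * M) + L ^ 3 * M ^ 3 + K * L ^ 2 * M ^ 2 * (M - L)
    + K ^ 3 * (L - M) * (L + M) ^ 2

/-- `γ_i`: the `i`-th elementary symmetric function of `(K, -L, M)`. -/
def gammaSymm (R : Type*) [CommRing R] (i : ℕ) : MvPolynomial (Fin 3) R :=
  MvPolynomial.aeval ![MvPolynomial.X 0, -MvPolynomial.X 1, MvPolynomial.X 2]
    (MvPolynomial.esymm (Fin 3) R i)

/-- The projective plane over `k`, with homogeneous coordinates `[K : L : M]`. -/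
abbrev ProjPlane (k : Type*) [Field k] : Type _ := ℙ k (Fin 3 → k)

/-- The quotient topology of `k³ ∖ {0} → P²(k)`. -/
instance projPlaneTopology (k : Type*) [Field k] [TopologicalSpace k] :
    TopologicalSpace (ProjPlane k) :=
  TopologicalSpace.coinduced
    (fun v : {v : Fin 3 → k // v ≠ 0} => Projectivization.mk k v.1 v.2) inferInstance

/-- The coordinate points `[1:0:0]`, `[0:1:0]`, `[0:0:1]`. -/
def coordPoint (k : Type*) [Field k] (i : Fin 3) : ProjPlane k :=
  Projectivization.mk k (Pi.single i 1) (by simp)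

/-- The curve `V = {[K:L:M] : Q(K,L,M) = 0}` in `P²(k)`. -/
def curveV (k : Type*) [Field k] : Set (ProjPlane k) :=
  {p | ∀ (v : Fin 3 → k) (hv : v ≠ 0), Projectivization.mk k v hv = p →
    MvPolynomial.eval v (sexticQ k) = 0}

/-- The singular points of `V`: the points of `V` where all partial derivatives of `Q` vanish. -/
def singularV (k : Type*) [Field k] : Set (ProjPlane k) :=
  {p | p ∈ curveV k ∧ ∀ (v : Fin 3 → k) (hv : v ≠ 0), Projectivization.mk k v hv = p →
    ∀ i : Fin 3, MvPolynomial.eval v (MvPolynomial.pderiv i (sexticQ k)) = 0}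

/-! ### Elliptic functions and holomorphic maps from a complex torus to the plane -/

/-- `f` is an elliptic function for the lattice `Γ`: a meromorphic function on `ℂ` that is
invariant under `Γ`. -/
def IsElliptic (Γ : PeriodPair) (f : ℂ → ℂ) : Prop :=
  Meromorphic f ∧ ∀ l ∈ Γ.lattice, ∀ z : ℂ, f (z + l) = f z

/-- `F : ℂ/Γ → P²(ℂ)` is holomorphic: locally it is given by three holomorphic functions without
common zeros as homogeneous coordinates. -/
def IsHolomorphicMap (Γ : PeriodPair) (F : (ℂ ⧸ Γ.lattice) → ProjPlane ℂ) : Prop :=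
  ∀ z₀ : ℂ, ∃ f : ℂ → (Fin 3 → ℂ), AnalyticAt ℂ f z₀ ∧
    ∀ᶠ z in nhds z₀, ∃ h : f z ≠ 0, F (Γ.lattice.mkQ z) = Projectivization.mk ℂ (f z) h

/-! ### Curvature of a Riemannian metric in coordinates -/

/-- Euclidean three-space. -/
abbrev E3 : Type := EuclideanSpace ℝ (Fin 3)

/-- The `i`-th partial derivative. -/
def partialD (i : Fin 3) (f : E3 → ℝ) (y : E3) : ℝ :=
  fderiv ℝ f y (EuclideanSpace.single i 1)

/-- The Christoffel symbol `Γ^k_{ij}` of the metric `g = (g_{ij})`. -/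
def christoffel (g : E3 → Matrix (Fin 3) (Fin 3) ℝ) (k i j : Fin 3) (y : E3) : ℝ :=
  (1 / 2) * ∑ l, (g y)⁻¹ k l *
    (partialD i (fun x => g x j l) y + partialD j (fun x => g x i l) y
      - partialD l (fun x => g x i j) y)

/-- The component `R^l_{kij}` of the Riemann curvature tensor of the metric `g = (g_{ij})`. -/
def riemannTensor (g : E3 → Matrix (Fin 3) (Fin 3) ℝ) (l k i j : Fin 3) (y : E3) : ℝ :=
  partialD i (christoffel g l j k) y - partialD j (christoffel g l i k) y
    + ∑ m, (christoffel g l i m y * christoffel g m j k y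
      - christoffel g l j m y * christoffel g m i k y)

/-- The exterior derivative `(dα)(v, w)` at `y` of a 1-form `α` on an open subset of `ℝ³`. -/
def dForm (α : E3 → E3 →L[ℝ] ℝ) (y v w : E3) : ℝ :=
  fderiv ℝ α y v w - fderiv ℝ α y w v

/-- The wedge product `(α ∧ β)(v, w)` of two covectors. -/
def wedge (α β : E3 →L[ℝ] ℝ) (v w : E3) : ℝ := α v * β w - α w * β v

/-- `σ` is a smooth coframe on `U ⊆ ℝ³` with
`dσ¹ = (L-K) σ²∧σ³`, `dσ² = (M+K) σ¹∧σ³`, `dσ³ = (L-M) σ¹∧σ²`.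
The upper indices 1, 2, 3 are 0, 1, 2 here. -/
structure IsStructureCoframe (K L M : ℝ) (U : Set E3) (σ : Fin 3 → E3 → E3 →L[ℝ] ℝ) :
    Prop where
  smooth : ∀ a, ContDiffOn ℝ ∞ (σ a) U
  indep : ∀ y ∈ U, LinearIndependent ℝ (fun a => σ a y)
  d1 : ∀ y ∈ U, ∀ v w, dForm (σ 0) y v w = (L - K) * wedge (σ 1 y) (σ 2 y) v w
  d2 : ∀ y ∈ U, ∀ v w, dForm (σ 1) y v w = (M + K) * wedge (σ 0 y) (σ 2 y) v w
  d3 : ∀ y ∈ U, ∀ v w, dForm (σ 2) y v w = (L - M) * wedge (σ 0 y) (σ 1 y) v w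

/-- The components of the Riemannian metric `∑ₐ σᵃ ⊗ σᵃ`, for which the frame dual to `σ` is
orthonormal. -/
def coframeMetric (σ : Fin 3 → E3 → E3 →L[ℝ] ℝ) (y : E3) : Matrix (Fin 3) (Fin 3) ℝ :=
  Matrix.of fun i j =>
    ∑ a, σ a y (EuclideanSpace.single i 1) * σ a y (EuclideanSpace.single j 1)

/-- A space `N³(K,L,M)`: a smooth simply connected 3-manifold with a global coframe `σ¹, σ², σ³`
(which is declared orthonormal and positively oriented, thus giving the metric and the orientation)
that satisfies the structure equations, i.e. satisfies them in every chart. Completeness is not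
imposed. -/
structure SpaceN3 (K L M : ℝ) where
  carrier : Type
  [top : TopologicalSpace carrier]
  [t2 : T2Space carrier]
  [secondCountable : SecondCountableTopology carrier]
  [simplyConnected : SimplyConnectedSpace carrier]
  [charted : ChartedSpace E3 carrier]
  [manifold : IsManifold (𝓡 3) ∞ carrier]
  σ : Fin 3 → ∀ x : carrier, TangentSpace (𝓡 3) x →L[ℝ] ℝ
  structureEqs : ∀ e ∈ atlas E3 carrier, IsStructureCoframe K L M e.target
    (fun a y => (σ a (e.symm y)).comp (mfderiv 𝓘(ℝ, E3) (𝓡 3) e.symm y))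

attribute [instance] SpaceN3.top SpaceN3.t2 SpaceN3.secondCountable SpaceN3.simplyConnected
  SpaceN3.charted SpaceN3.manifold

/-- The coframe of `N` in a chart `e`, i.e. its pullback under `e⁻¹`. -/
def SpaceN3.localCoframe {K L M : ℝ} (N : SpaceN3 K L M)
    (e : OpenPartialHomeomorph N.carrier E3) (a : Fin 3) (y : E3) : E3 →L[ℝ] ℝ :=
  (N.σ a (e.symm y)).comp (mfderiv 𝓘(ℝ, E3) (𝓡 3) e.symm y)

/-- The metric of `N` is flat: its Riemann curvature tensor vanishes in every chart. -/
def SpaceN3.IsFlat {K L M : ℝ} (N : SpaceN3 K L M) : Prop :=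
  ∀ e ∈ atlas E3 N.carrier, ∀ y ∈ e.target, ∀ l k i j : Fin 3,
    riemannTensor (coframeMetric (N.localCoframe e)) l k i j y = 0

end

/-! The standard Cremona involution [K:L:M] ↦ [LM:KM:KL] reduces the sextic to a cubic: Q(K,L,M) =
C(LM,KM,KL) with C = `cremonaCubic`. In the coordinates X = a/(b-c), Y = -(b+c)/(b-c) the cubic
C(a,b,c) = 0 becomes the elliptic curve Y² = X³ + X² - X. The involution is invertible off the
coordinate triangle and contracts each side of it to a vertex. On a side, Q is up to sign the cube
of the product of the other two coordinates, so V meets the triangle only in its vertices. The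
vertices are therefore the only possible singular points, because the cubic is smooth
(`singularV_eq`).

Complex parametrization: a lattice with g₂ = 16/3, g₃ = -44/27 gives X = ℘ - 1/3, Y = ℘'/2. Such a
lattice exists because E₆²/E₄³ takes every value in [0,1) on the imaginary axis (`exists_E₆_sq_eq`).
The pair (℘, ℘') maps ℂ minus the lattice onto the affine cubic and separates points modulo the
lattice; composing with the involution gives `curveMap`.

Real curve: lines through the 2-torsion point (0,0) meet the cubic in two further points, with
X-coordinates of product -1. Hence there are two components, each parametrized by the projective
line of slopes. Each component carries one point over each vertex, and these cut it into three arcs.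

Geometry: the Levi-Civita connection forms of the coframe have constant coefficients, given by K, L,
M, so Cartan's second equation makes the curvature a constant quadratic expression in K, L, M. It
vanishes exactly when KL = KM = LM = 0. The spaces exist because the structure equations can be
integrated explicitly on all of ℝ³. -/

/-! ### The sextic, symmetric functions and the Cremona cubic. -/

/-- The value of the sextic `Q` at a point. -/
theorem eval_sexticQ {k : Type*} [CommRing k] (v : Fin 3 → k) :
    MvPolynomial.eval v (sexticQ k) =
      -(v 0 ^ 2 * v 1 * (v 1 - v 2) ^ 2 * v 2) + v 1 ^ 3 * v 2 ^ 3
        + v 0 * v 1 ^ 2 * v 2 ^ 2 * (v 2 - v 1) + v 0 ^ 3 * (v 1 - v 2) * (v 1 + v 2) ^ 2 := by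
  simp [sexticQ]

theorem gammaSymm_one (R : Type*) [CommRing R] :
    gammaSymm R 1 = MvPolynomial.X 0 - MvPolynomial.X 1 + MvPolynomial.X 2 := by
  simp [gammaSymm, MvPolynomial.esymm_one, Fin.sum_univ_three]
  ring

theorem gammaSymm_two (R : Type*) [CommRing R] :
    gammaSymm R 2 = -(MvPolynomial.X 0 * MvPolynomial.X 1) + MvPolynomial.X 0 * MvPolynomial.X 2
      - MvPolynomial.X 1 * MvPolynomial.X 2 := by
  have h : Finset.powersetCard 2 (Finset.univ : Finset (Fin 3)) = {{0, 1}, {0, 2}, {1, 2}} := by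
    decide
  rw [gammaSymm, MvPolynomial.esymm, h, Finset.sum_insert (by decide),
    Finset.sum_insert (by decide), Finset.sum_singleton, Finset.prod_pair (by decide),
    Finset.prod_pair (by decide), Finset.prod_pair (by decide)]
  simp
  ring

theorem gammaSymm_three (R : Type*) [CommRing R] :
    gammaSymm R 3 = -(MvPolynomial.X 0 * MvPolynomial.X 1 * MvPolynomial.X 2) := by
  have h : Finset.powersetCard 3 (Finset.univ : Finset (Fin 3)) = {Finset.univ} := by decide
  rw [gammaSymm, MvPolynomial.esymm, h, Finset.sum_singleton, Fin.prod_univ_three]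
  simp

theorem sexticQ_eq_gammaSymm (R : Type*) [CommRing R] :
    sexticQ R = 4 * gammaSymm R 1 * gammaSymm R 2 * gammaSymm R 3
      - gammaSymm R 2 ^ 3 - 4 * gammaSymm R 3 ^ 2 := by
  rw [gammaSymm_one, gammaSymm_two, gammaSymm_three, sexticQ]
  ring

/-- The smooth plane cubic that the standard Cremona involution carries to the sextic `Q = 0`. -/
def cremonaCubic {k : Type*} [CommRing k] (a b c : k) : k :=
  a ^ 3 + a ^ 2 * (b - c) - a * (b - c) ^ 2 - (b - c) * (b + c) ^ 2

theorem eval_sexticQ_eq_cremonaCubic {k : Type*} [CommRing k] (v : Fin 3 → k) :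
    MvPolynomial.eval v (sexticQ k) = cremonaCubic (v 1 * v 2) (v 0 * v 2) (v 0 * v 1) := by
  rw [eval_sexticQ, cremonaCubic]
  ring

theorem eval_sexticQ_cremona {k : Type*} [CommRing k] (a b c : k) :
    MvPolynomial.eval ![b * c, a * c, a * b] (sexticQ k) = (a * b * c) ^ 3 * cremonaCubic a b c := by
  simp only [eval_sexticQ, cremonaCubic, Matrix.cons_val]
  ring

theorem eval_sexticQ_smul {k : Type*} [CommRing k] (r : k) (v : Fin 3 → k) :
    MvPolynomial.eval (r • v) (sexticQ k) = r ^ 6 * MvPolynomial.eval v (sexticQ k) := by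
  simp only [eval_sexticQ, Pi.smul_apply, smul_eq_mul]
  ring

/-! ### Vertices and singular points of the curve. -/

section
variable {k : Type*} [Field k]

theorem mk_mem_curveV {v : Fin 3 → k} (hv : v ≠ 0) :
    Projectivization.mk k v hv ∈ curveV k ↔ MvPolynomial.eval v (sexticQ k) = 0 := by
  refine ⟨fun h => h v hv rfl, fun h w hw e => ?_⟩
  obtain ⟨r, rfl⟩ := (Projectivization.mk_eq_mk_iff' k w v hw hv).1 e
  rw [eval_sexticQ_smul, h, mul_zero]

theorem mk_eq_coordPoint {v : Fin 3 → k} (hv : v ≠ 0) (i : Fin 3) :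
    Projectivization.mk k v hv = coordPoint k i ↔ ∀ j, j ≠ i → v j = 0 := by
  rw [coordPoint, Projectivization.mk_eq_mk_iff']
  constructor
  · rintro ⟨r, rfl⟩ j hj
    simp [hj]
  · intro h
    refine ⟨v i, funext fun j => ?_⟩
    rcases eq_or_ne j i with rfl | hj
    · simp
    · simp [hj, h j hj]

/-- A vertex has at most one nonzero coordinate. Pairwise products express this in the form in which
both the sextic and the curvature deliver it. -/
theorem mk_mem_coordPoints {v : Fin 3 → k} (hv : v ≠ 0) :
    Projectivization.mk k v hv ∈
        ({coordPoint k 0, coordPoint k 1, coordPoint k 2} : Set (ProjPlane k)) ↔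
      v 0 * v 1 = 0 ∧ v 0 * v 2 = 0 ∧ v 1 * v 2 = 0 := by
  simp only [Set.mem_insert_iff, Set.mem_singleton_iff, mk_eq_coordPoint, Fin.forall_fin_succ,
    mul_eq_zero]
  simp
  tauto

/-- On the curve, if one homogeneous coordinate vanishes then so does a second one. -/
theorem mul_eq_zero_of_eval_sexticQ_eq_zero {v : Fin 3 → k}
    (h : MvPolynomial.eval v (sexticQ k) = 0) (h0 : v 0 * v 1 * v 2 = 0) :
    v 0 * v 1 = 0 ∧ v 0 * v 2 = 0 ∧ v 1 * v 2 = 0 := by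
  rw [eval_sexticQ] at h
  rcases mul_eq_zero.1 h0 with h0 | h2
  · rcases mul_eq_zero.1 h0 with h0 | h1
    -- On each side of the triangle only one monomial of Q survives: plus or minus the cube of the
    -- product of the other two coordinates.
    · have : (v 1 * v 2) ^ 3 = 0 := by rw [h0] at h; linear_combination h
      simp [h0, pow_eq_zero_iff] at this ⊢
      tauto
    · have : (v 0 * v 2) ^ 3 = 0 := by rw [h1] at h; linear_combination -h
      simp [h1, pow_eq_zero_iff] at this ⊢
      tauto
  · have : (v 0 * v 1) ^ 3 = 0 := by rw [h2] at h; linear_combination h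
    simp [h2, pow_eq_zero_iff] at this ⊢
    tauto

/-- The partial derivatives of the cubic have no common zero besides the origin. -/
theorem cremonaCubic_smooth [CharZero k] {a b c : k}
    (ha : 3 * a ^ 2 + 2 * a * (b - c) - (b - c) ^ 2 = 0)
    (hd : a ^ 2 - 2 * a * (b - c) - (b + c) ^ 2 = 0) (hs : (b - c) * (b + c) = 0) : a = 0 := by
  rcases mul_eq_zero.1 hs with h | h
  · rw [h] at ha
    simpa using ha
  · rw [h] at hd
    have h1 : a * (a - 2 * (b - c)) = 0 := by linear_combination hd
    rcases mul_eq_zero.1 h1 with h1 | h1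
    · exact h1
    -- Inserting a = 2(b-c) in the a-derivative gives (12 + 4 - 1)(b-c)².
    · have h2 : 15 * (b - c) ^ 2 = 0 := by
        rw [sub_eq_zero.1 h1] at ha
        linear_combination ha
      have h3 : b - c = 0 := by simpa using h2
      rw [sub_eq_zero.1 h1, h3, mul_zero]

theorem eval_pderiv_sexticQ (v : Fin 3 → k) :
    (MvPolynomial.eval v (MvPolynomial.pderiv 0 (sexticQ k)) =
      -(2 * v 0 * v 1 * (v 1 - v 2) ^ 2 * v 2) + v 1 ^ 2 * v 2 ^ 2 * (v 2 - v 1)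
        + 3 * v 0 ^ 2 * (v 1 - v 2) * (v 1 + v 2) ^ 2) ∧
    (MvPolynomial.eval v (MvPolynomial.pderiv 1 (sexticQ k)) =
      -(v 0 ^ 2 * (v 1 - v 2) ^ 2 * v 2) - 2 * v 0 ^ 2 * v 1 * (v 1 - v 2) * v 2
        + 3 * v 1 ^ 2 * v 2 ^ 3 + 2 * v 0 * v 1 * v 2 ^ 2 * (v 2 - v 1) - v 0 * v 1 ^ 2 * v 2 ^ 2
        + v 0 ^ 3 * (v 1 + v 2) ^ 2 + 2 * v 0 ^ 3 * (v 1 - v 2) * (v 1 + v 2)) ∧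
    (MvPolynomial.eval v (MvPolynomial.pderiv 2 (sexticQ k)) =
      -(v 0 ^ 2 * v 1 * (v 1 - v 2) ^ 2) + 2 * v 0 ^ 2 * v 1 * (v 1 - v 2) * v 2
        + 3 * v 1 ^ 3 * v 2 ^ 2 + 2 * v 0 * v 1 ^ 2 * v 2 * (v 2 - v 1) + v 0 * v 1 ^ 2 * v 2 ^ 2
        - v 0 ^ 3 * (v 1 + v 2) ^ 2 + 2 * v 0 ^ 3 * (v 1 - v 2) * (v 1 + v 2)) := by
  refine ⟨?_, ?_, ?_⟩ <;>
  · simp [sexticQ, Derivation.leibniz, Derivation.leibniz_pow, MvPolynomial.pderiv_X]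
    ring

/-- Off the triangle the chain rule for Q = C(a,b,c), a = LM, b = KM, c = KL, gives K∂_K Q = b C_b +
c C_c and its analogues. Combinations such as L∂_L Q + M∂_M Q - K∂_K Q = 2a C_a isolate the partial
derivatives of C, which have no common zero with a ≠ 0. -/
theorem singularV_eq [CharZero k] :
    singularV k = {coordPoint k 0, coordPoint k 1, coordPoint k 2} := by
  ext p
  induction p using Projectivization.ind with | h v hv
  rw [mk_mem_coordPoints]
  constructor
  · rintro ⟨h, h'⟩
    have hQ := (mk_mem_curveV hv).1 h
    by_cases h0 : v 0 * v 1 * v 2 = 0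
    · exact mul_eq_zero_of_eval_sexticQ_eq_zero hQ h0
    exfalso
    obtain ⟨e0, e1, e2⟩ := eval_pderiv_sexticQ v
    have hK := e0.symm.trans (h' v hv rfl 0)
    have hL := e1.symm.trans (h' v hv rfl 1)
    have hM := e2.symm.trans (h' v hv rfl 2)
    simp only [mul_eq_zero, not_or] at h0
    obtain ⟨⟨hv0, hv1⟩, hv2⟩ := h0
    have hcancel : ∀ {x y : k}, x ≠ 0 → 2 * x * y = 0 → y = 0 := fun hx h => by
      simpa [hx] using h
    have ha : 3 * (v 1 * v 2) ^ 2 + 2 * (v 1 * v 2) * (v 0 * v 2 - v 0 * v 1)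
        - (v 0 * v 2 - v 0 * v 1) ^ 2 = 0 :=
      hcancel (mul_ne_zero hv1 hv2)
        (by linear_combination v 1 * hL + v 2 * hM - v 0 * hK)
    have hb : (v 1 * v 2) ^ 2 - 2 * (v 1 * v 2) * (v 0 * v 2 - v 0 * v 1)
        - (v 0 * v 2 + v 0 * v 1) ^ 2
        - 2 * ((v 0 * v 2 - v 0 * v 1) * (v 0 * v 2 + v 0 * v 1)) = 0 :=
      hcancel (mul_ne_zero hv0 hv2)
        (by linear_combination v 0 * hK + v 2 * hM - v 1 * hL)
    have hc : -((v 1 * v 2) ^ 2 - 2 * (v 1 * v 2) * (v 0 * v 2 - v 0 * v 1)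
        - (v 0 * v 2 + v 0 * v 1) ^ 2)
        - 2 * ((v 0 * v 2 - v 0 * v 1) * (v 0 * v 2 + v 0 * v 1)) = 0 :=
      hcancel (mul_ne_zero hv0 hv1)
        (by linear_combination v 0 * hK + v 1 * hL - v 2 * hM)
    refine mul_ne_zero hv1 hv2 (cremonaCubic_smooth ha
      (hcancel one_ne_zero (by linear_combination hb - hc))
      (hcancel (x := 2) two_ne_zero (by linear_combination -(hb + hc))))
  · rintro ⟨h1, h2, h3⟩
    have key : ∀ w : Fin 3 → k, w 0 * w 1 = 0 → w 0 * w 2 = 0 → w 1 * w 2 = 0 →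
        MvPolynomial.eval w (sexticQ k) = 0 ∧
          ∀ i, MvPolynomial.eval w (MvPolynomial.pderiv i (sexticQ k)) = 0 := by
      intro w h1 h2 h3
      obtain ⟨e0, e1, e2⟩ := eval_pderiv_sexticQ w
      have h : (w 0 = 0 ∧ w 1 = 0) ∨ (w 0 = 0 ∧ w 2 = 0) ∨ (w 1 = 0 ∧ w 2 = 0) := by
        simp only [mul_eq_zero] at h1 h2 h3
        tauto
      rw [eval_sexticQ, Fin.forall_fin_succ, Fin.forall_fin_succ, Fin.forall_fin_succ]
      simp only [Fin.succ_zero_eq_one, Fin.succ_one_eq_two, e0, e1, e2]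
      rcases h with h | h | h <;> simp [h.1, h.2]
    refine ⟨(mk_mem_curveV hv).2 (key v h1 h2 h3).1, fun w hw e => (key w ?_ ?_ ?_).2⟩ <;>
    · obtain ⟨r, rfl⟩ := (Projectivization.mk_eq_mk_iff' k w v hw hv).1 e
      simp only [Pi.smul_apply, smul_eq_mul, mul_mul_mul_comm r, h1, h2, h3, mul_zero]

end

/-! ### The real curve -/

/-! ### The Cremona involution on homogeneous coordinates. -/

section Cremona
variable {k : Type*} [Field k]

/-- The standard quadratic Cremona transformation in homogeneous coordinates. -/
def cremonaVec (v : Fin 3 → k) : Fin 3 → k := ![v 1 * v 2, v 0 * v 2, v 0 * v 1]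

theorem eval_sexticQ_cremonaVec (v : Fin 3 → k) :
    MvPolynomial.eval (cremonaVec v) (sexticQ k) =
      (v 0 * v 1 * v 2) ^ 3 * cremonaCubic (v 0) (v 1) (v 2) :=
  eval_sexticQ_cremona _ _ _

theorem cremonaVec_cremonaVec (v : Fin 3 → k) :
    cremonaVec (cremonaVec v) = (v 0 * v 1 * v 2) • v := by
  ext i
  fin_cases i <;> simp [cremonaVec] <;> ring

theorem cremonaVec_smul (r : k) (v : Fin 3 → k) :
    cremonaVec (r • v) = r ^ 2 • cremonaVec v := by
  ext i
  fin_cases i <;> simp [cremonaVec] <;> ring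

/-- A nonzero point of the cubic has at most one vanishing coordinate. -/
theorem cremonaVec_ne_zero {v : Fin 3 → k} (hv : v ≠ 0)
    (h : cremonaCubic (v 0) (v 1) (v 2) = 0) : cremonaVec v ≠ 0 := by
  intro h0
  apply hv
  have e0 : v 1 * v 2 = 0 := congrFun h0 0
  have e1 : v 0 * v 2 = 0 := congrFun h0 1
  have e2 : v 0 * v 1 = 0 := congrFun h0 2
  rw [cremonaCubic] at h
  have key : v 0 = 0 ∧ v 1 = 0 ∧ v 2 = 0 := by
    rcases mul_eq_zero.1 e0 with e | e <;> rcases mul_eq_zero.1 e1 with e' | e' <;>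
      rcases mul_eq_zero.1 e2 with e'' | e'' <;> simp [e, e', e''] at h ⊢ <;> simp_all
  ext i
  fin_cases i
  exacts [key.1, key.2.1, key.2.2]

theorem mk_cremonaVec_mem_curveV {v : Fin 3 → k} (hv : cremonaVec v ≠ 0)
    (h : cremonaCubic (v 0) (v 1) (v 2) = 0) :
    Projectivization.mk k (cremonaVec v) hv ∈ curveV k := by
  rw [mk_mem_curveV, eval_sexticQ_cremonaVec, h, mul_zero]

/-- The whole side `v i = 0` is contracted to the i-th vertex, so several points of the cubic may
lie over one vertex. -/
theorem mk_cremonaVec_eq_coordPoint {v : Fin 3 → k} (hv : cremonaVec v ≠ 0) (i : Fin 3) :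
    Projectivization.mk k (cremonaVec v) hv = coordPoint k i ↔ v i = 0 := by
  rw [mk_eq_coordPoint]
  have hv' : ¬ (v 1 * v 2 = 0 ∧ v 0 * v 2 = 0 ∧ v 0 * v 1 = 0) := by
    rintro ⟨h0, h1, h2⟩
    exact hv (by ext j; fin_cases j <;> simp [cremonaVec, h0, h1, h2])
  fin_cases i <;> simp [Fin.forall_fin_succ, cremonaVec] at hv' ⊢ <;> tauto

/-- A point outside the coordinate triangle determines its Cremona preimage. -/
theorem exists_smul_eq_of_mk_cremonaVec_eq {v w : Fin 3 → k} (hv : cremonaVec v ≠ 0)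
    (hw : cremonaVec w ≠ 0)
    (h : Projectivization.mk k (cremonaVec v) hv = Projectivization.mk k (cremonaVec w) hw)
    (h0 : v 0 * v 1 * v 2 ≠ 0) : ∃ r : k, v = r • w := by
  obtain ⟨r, hr⟩ := (Projectivization.mk_eq_mk_iff' k _ _ hv hw).1 h
  have := congrArg cremonaVec hr
  rw [cremonaVec_smul, cremonaVec_cremonaVec, cremonaVec_cremonaVec, smul_smul] at this
  refine ⟨(v 0 * v 1 * v 2)⁻¹ * (r ^ 2 * (w 0 * w 1 * w 2)), ?_⟩
  rw [mul_smul, this, smul_smul, inv_mul_cancel₀ h0, one_smul]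

/-- The curve outside the coordinate triangle is the Cremona image of the cubic. -/
theorem cremonaCubic_cremonaVec_eq_zero {v : Fin 3 → k}
    (h : MvPolynomial.eval v (sexticQ k) = 0) :
    cremonaCubic (cremonaVec v 0) (cremonaVec v 1) (cremonaVec v 2) = 0 := by
  rw [eval_sexticQ_eq_cremonaCubic] at h
  exact h

end Cremona

theorem continuous_mk_projPlane {k X : Type*} [Field k] [TopologicalSpace k] [TopologicalSpace X]
    {f : X → Fin 3 → k} (hf : Continuous f) (h0 : ∀ x, f x ≠ 0) :
    Continuous fun x => Projectivization.mk k (f x) (h0 x) := by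
  have h : Continuous (fun v : {v : Fin 3 → k // v ≠ 0} => Projectivization.mk k v.1 v.2) :=
    continuous_coinduced_rng
  exact h.comp (hf.subtype_mk h0)

/-! ### The real cubic parametrized by slopes. -/

/-- The positive root of `Z² = (p² - q²) Z + q⁴`. -/
noncomputable def arcRoot (p q : ℝ) : ℝ := (p ^ 2 - q ^ 2 + √((p ^ 2 - q ^ 2) ^ 2 + 4 * q ^ 4)) / 2

theorem arcRoot_sq (p q : ℝ) : arcRoot p q ^ 2 = (p ^ 2 - q ^ 2) * arcRoot p q + q ^ 4 := by
  have := Real.sq_sqrt (show 0 ≤ (p ^ 2 - q ^ 2) ^ 2 + 4 * q ^ 4 by positivity)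
  rw [arcRoot]
  linear_combination this / 4

theorem arcRoot_pos {p q : ℝ} (h : p ≠ 0 ∨ q ≠ 0) : 0 < arcRoot p q := by
  rw [arcRoot]
  rcases eq_or_ne q 0 with rfl | hq
  · have hp : p ≠ 0 := by tauto
    rw [show p ^ 2 - (0 : ℝ) ^ 2 = p ^ 2 by ring]
    positivity
  · have : |p ^ 2 - q ^ 2| < √((p ^ 2 - q ^ 2) ^ 2 + 4 * q ^ 4) := by
      apply Real.lt_sqrt_of_sq_lt
      rw [sq_abs]
      have : 0 < q ^ 4 := by positivity
      linarith
    linarith [neg_abs_le (p ^ 2 - q ^ 2)]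

/-- The two roots of the quadratic have product -q⁴ ≤ 0, so they cannot both be positive. -/
theorem eq_arcRoot {p q z : ℝ} (h : p ≠ 0 ∨ q ≠ 0) (hz : 0 < z)
    (e : z ^ 2 = (p ^ 2 - q ^ 2) * z + q ^ 4) : z = arcRoot p q := by
  have h1 := arcRoot_sq p q
  have h2 := arcRoot_pos h
  by_contra hne
  have h3 : z + arcRoot p q = p ^ 2 - q ^ 2 :=
    mul_left_cancel₀ (sub_ne_zero.2 hne) (by linear_combination e - h1)
  have h4 : q ^ 4 = -(z * arcRoot p q) := by linear_combination -h1 + arcRoot p q * h3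
  have : 0 < z * arcRoot p q := mul_pos hz h2
  have : 0 ≤ q ^ 4 := by positivity
  linarith

theorem continuous_arcRoot : Continuous fun x : ℝ × ℝ => arcRoot x.1 x.2 := by
  unfold arcRoot
  fun_prop

theorem arcRoot_smul {r : ℝ} (hr : r ≠ 0) {p q : ℝ} (h : p ≠ 0 ∨ q ≠ 0) :
    arcRoot (r * p) (r * q) = r ^ 2 * arcRoot p q := by
  symm
  apply eq_arcRoot
  · simpa [hr] using h
  · have := arcRoot_pos h
    positivity
  · linear_combination r ^ 4 * arcRoot_sq p q

/-- The points of the two components of the real cubic, parametrized by the slope `p / q` of the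
lines through its point `[0 : 1 : -1]`. -/
noncomputable def cubicPoint (s : Fin 2) (p q : ℝ) : Fin 3 → ℝ :=
  ![![2 * arcRoot p q * q, q ^ 3 - p * arcRoot p q, -q ^ 3 - p * arcRoot p q],
    ![-2 * q ^ 2, arcRoot p q + p * q, p * q - arcRoot p q]] s

theorem continuous_cubicPoint (s : Fin 2) :
    Continuous fun x : ℝ × ℝ => cubicPoint s x.1 x.2 := by
  have := continuous_arcRoot
  refine continuous_pi fun i => ?_
  fin_cases s <;> fin_cases i <;> simp [cubicPoint] <;> fun_prop

/-- The line Y = (p/q) X meets Y² = X³ + X² - X outside the origin where X² + (1 - p²/q²) X - 1 = 0.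
With Z = `arcRoot p q` the roots are X = Z/q² > 0 and X = -q²/Z < 0, giving the components s = 0 and
s = 1; the coordinates of `cubicPoint` are these points with denominators cleared. -/
theorem cubicPoint_mem (s : Fin 2) (p q : ℝ) :
    cremonaCubic (cubicPoint s p q 0) (cubicPoint s p q 1) (cubicPoint s p q 2) = 0 := by
  have h := arcRoot_sq p q
  fin_cases s <;> simp [cubicPoint, cremonaCubic]
  · linear_combination 8 * q ^ 3 * arcRoot p q * h
  · linear_combination 8 * q ^ 2 * h

/-- The sign that tells the two components of the real cubic apart. -/
def arcSign (s : Fin 2) : ℝ := ![1, -1] s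

theorem arcSign_sq (s : Fin 2) : arcSign s * arcSign s = 1 := by
  fin_cases s <;> simp [arcSign]

theorem cubicPoint_zero_eq_zero {s : Fin 2} {p q : ℝ} (h : p ≠ 0 ∨ q ≠ 0) :
    cubicPoint s p q 0 = 0 ↔ q = 0 := by
  have := (arcRoot_pos h).ne'
  fin_cases s <;> simp [cubicPoint, this]

/-- On the line b = 0 the cubic is (a-c)²(a+c): a simple point of slope 1 and a tangency of slope
-1, lying on different components. Eliminating `arcRoot` accordingly leaves a power of q times
(p-q)(p+q)², and positivity of the root decides which slope belongs to the component s. -/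
theorem cubicPoint_one_eq_zero {s : Fin 2} {p q : ℝ} (h : p ≠ 0 ∨ q ≠ 0) :
    cubicPoint s p q 1 = 0 ↔ p = arcSign s * q := by
  have h1 := arcRoot_sq p q
  have h2 := arcRoot_pos h
  have hq : 0 ≤ q ^ 2 := sq_nonneg q
  fin_cases s <;> simp only [cubicPoint, arcSign, Fin.zero_eta, Fin.mk_one, Matrix.cons_val]
  · constructor
    · intro e
      have h3 : q ^ 3 * ((p - q) * (p + q) * (p + q)) = 0 := by
        linear_combination -p ^ 2 * h1 + (-q ^ 3 - p * arcRoot p q + p * (p ^ 2 - q ^ 2)) * e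
      have hq : q ≠ 0 := by
        rintro rfl
        have : p = 0 := by simpa [h2.ne'] using e
        tauto
      have h4 : (p - q) = 0 ∨ p + q = 0 := by simpa [hq] using h3
      rcases h4 with h4 | h4
      · linarith
      · have : q * (q ^ 2 + arcRoot p q) = 0 := by linear_combination e + arcRoot p q * h4
        simp only [mul_eq_zero, hq, false_or] at this
        nlinarith [sq_nonneg q]
    · rintro rfl
      have : arcRoot (1 * q) q = q ^ 2 :=
        (eq_arcRoot h (by rcases h with h | h <;> [simp at h; skip] <;> positivity) (by ring)).symm
      rw [this]; ring
  · constructor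
    · intro e
      have h3 : q * ((p - q) * (p + q) * (p + q)) = 0 := by
        linear_combination h1 + (-arcRoot p q + p * q + (p ^ 2 - q ^ 2)) * e
      have hq : q ≠ 0 := by
        rintro rfl
        simp [h2.ne'] at e
      have h4 : (p - q) = 0 ∨ p + q = 0 := by simpa [hq] using h3
      rcases h4 with h4 | h4
      · rw [sub_eq_zero.1 h4] at e h2
        nlinarith
      · linarith
    · rintro rfl
      have : arcRoot (-1 * q) q = q ^ 2 :=
        (eq_arcRoot h (by rcases h with h | h <;> [simp at h; skip] <;> positivity) (by ring)).symm
      rw [this]; ring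

theorem arcRoot_neg (p q : ℝ) : arcRoot (-p) q = arcRoot p q := by simp [arcRoot]

theorem cubicPoint_two_eq_zero {s : Fin 2} {p q : ℝ} (h : p ≠ 0 ∨ q ≠ 0) :
    cubicPoint s p q 2 = 0 ↔ p = -(arcSign s * q) := by
  have e : cubicPoint s p q 2 = -cubicPoint s (-p) q 1 := by
    fin_cases s <;> simp [cubicPoint, arcRoot_neg] <;> ring
  rw [e, neg_eq_zero, cubicPoint_one_eq_zero (by simpa using h), neg_eq_iff_eq_neg]

theorem cubicPoint_ne_zero (s : Fin 2) {p q : ℝ} (h : p ≠ 0 ∨ q ≠ 0) : cubicPoint s p q ≠ 0 := by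
  intro h0
  have hq := (cubicPoint_zero_eq_zero h).1 (congrFun h0 0)
  have hp := (cubicPoint_one_eq_zero h).1 (congrFun h0 1)
  rw [hq, mul_zero] at hp
  tauto

theorem cremonaVec_cubicPoint_ne_zero (s : Fin 2) {p q : ℝ} (h : p ≠ 0 ∨ q ≠ 0) :
    cremonaVec (cubicPoint s p q) ≠ 0 :=
  cremonaVec_ne_zero (cubicPoint_ne_zero s h) (cubicPoint_mem s p q)

theorem cubicPoint_smul (s : Fin 2) {r : ℝ} (hr : r ≠ 0) {p q : ℝ} (h : p ≠ 0 ∨ q ≠ 0) :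
    ∃ c : ℝ, cubicPoint s (r * p) (r * q) = c • cubicPoint s p q := by
  refine ⟨![r ^ 3, r ^ 2] s, funext fun i => ?_⟩
  fin_cases s <;> fin_cases i <;> simp [cubicPoint, arcRoot_smul hr h] <;> ring

/-- The slope is recovered as -(b+c)/a and the component from the sign of a(b-c), which is the sign
of X; neither depends on the scaling factor. -/
theorem cubicPoint_injective {s s' : Fin 2} {p q p' q' r : ℝ} (h : p ≠ 0 ∨ q ≠ 0)
    (h' : p' ≠ 0 ∨ q' ≠ 0) (hq : q ≠ 0) (e : cubicPoint s p q = r • cubicPoint s' p' q') :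
    s = s' ∧ p * q' = p' * q := by
  have hr : r ≠ 0 := by
    rintro rfl
    exact cubicPoint_ne_zero s h (by simpa using e)
  have e0 : cubicPoint s p q 0 = r * cubicPoint s' p' q' 0 := congrFun e 0
  have e1 : cubicPoint s p q 1 = r * cubicPoint s' p' q' 1 := congrFun e 1
  have e2 : cubicPoint s p q 2 = r * cubicPoint s' p' q' 2 := congrFun e 2
  have hq' : q' ≠ 0 := by
    intro h0
    rw [(cubicPoint_zero_eq_zero h').2 h0, mul_zero] at e0
    exact hq ((cubicPoint_zero_eq_zero h).1 e0)
  have slope : ∀ (s : Fin 2) (p q : ℝ),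
      -(cubicPoint s p q 1 + cubicPoint s p q 2) * q = p * cubicPoint s p q 0 := by
    intro s p q
    fin_cases s <;> simp [cubicPoint] <;> ring
  have sign : ∀ (s : Fin 2) (p q : ℝ), q ≠ 0 →
      0 < arcSign s * (cubicPoint s p q 0 * (cubicPoint s p q 1 - cubicPoint s p q 2)) := by
    intro s p q hq
    have := arcRoot_pos (p := p) (Or.inr hq)
    fin_cases s <;> simp only [cubicPoint, arcSign, Fin.zero_eta, Fin.mk_one, Matrix.cons_val]
    · have : 0 < 4 * arcRoot p q * q ^ 4 := by positivity
      linarith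
    · have : 0 < 4 * arcRoot p q * q ^ 2 := by positivity
      linarith
  constructor
  · have h1 := sign s p q hq
    have h2 := sign s' p' q' hq'
    rw [e0, e1, e2] at h1
    by_contra hne
    have hs : arcSign s = -arcSign s' := by
      fin_cases s <;> fin_cases s' <;> simp [arcSign] at hne ⊢
    rw [hs] at h1
    have : 0 < r ^ 2 := by positivity
    nlinarith
  · have h1 := slope s p q
    have h2 := slope s' p' q'
    rw [e0, e1, e2] at h1
    have h0 : cubicPoint s' p' q' 0 ≠ 0 := fun h0 => hq' ((cubicPoint_zero_eq_zero h').1 h0)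
    apply mul_left_cancel₀ (mul_ne_zero hr h0)
    linear_combination -q' * h1 + r * q * h2

/-- The parameters are forced: q = a, p = -(b+c), and the root is a³/(b-c) if X > 0 and -a(b-c) if X
< 0. The equation of the cubic says that this number solves the quadratic of `arcRoot`. -/
theorem exists_cubicPoint {v : Fin 3 → ℝ} (hC : cremonaCubic (v 0) (v 1) (v 2) = 0)
    (h0 : v 0 ≠ 0) : ∃ (s : Fin 2) (r : ℝ), cubicPoint s (-(v 1 + v 2)) (v 0) = r • v := by
  have hd : v 1 - v 2 ≠ 0 := by
    intro hd
    rw [cremonaCubic, hd] at hC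
    exact h0 (by simpa using hC)
  rw [cremonaCubic] at hC
  rcases lt_or_gt_of_ne (mul_ne_zero h0 hd) with h | h
  · have e := eq_arcRoot (p := -(v 1 + v 2)) (Or.inr h0) (neg_pos.2 h)
      (by linear_combination (-v 0) * hC)
    refine ⟨1, -2 * v 0, funext fun i => ?_⟩
    fin_cases i <;> simp only [cubicPoint, ← e, Fin.zero_eta, Fin.mk_one, Fin.reduceFinMk,
      Matrix.cons_val, Pi.smul_apply, smul_eq_mul] <;> ring
  · have hz : 0 < v 0 ^ 3 / (v 1 - v 2) := by
      have : v 0 ^ 3 / (v 1 - v 2) = v 0 ^ 2 * (v 0 * (v 1 - v 2)) / (v 1 - v 2) ^ 2 := by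
        field_simp
      rw [this]
      positivity
    have e := eq_arcRoot (p := -(v 1 + v 2)) (Or.inr h0) hz (by
      field_simp
      linear_combination hC)
    refine ⟨0, 2 * v 0 ^ 3 / (v 1 - v 2), funext fun i => ?_⟩
    fin_cases i <;> simp only [cubicPoint, ← e, Fin.zero_eta, Fin.mk_one, Fin.reduceFinMk,
      Matrix.cons_val, Pi.smul_apply, smul_eq_mul] <;> field_simp <;> ring

/-! ### The six arcs. -/

/-- The slope parameters `(p, q)` of the six arcs. -/
def arcParam (s : Fin 2) (j : Fin 3) (t : ℝ) : ℝ × ℝ :=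
  ![(1, arcSign s * t), (arcSign s * (1 - 2 * t), 1), (1, arcSign s * (t - 1))] j

theorem continuous_arcParam (s : Fin 2) (j : Fin 3) : Continuous (arcParam s j) := by
  change Continuous fun t => arcParam s j t
  fin_cases j <;> simp only [arcParam, Fin.zero_eta, Fin.mk_one, Fin.reduceFinMk,
    Matrix.cons_val] <;> fun_prop

theorem arcParam_ne_zero (s : Fin 2) (j : Fin 3) (t : ℝ) :
    (arcParam s j t).1 ≠ 0 ∨ (arcParam s j t).2 ≠ 0 := by
  fin_cases j <;> simp [arcParam]

/-- The point with parameter `t` of an arc of the real cubic. -/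
noncomputable def arcPoint (s : Fin 2) (j : Fin 3) (t : ℝ) : Fin 3 → ℝ :=
  cubicPoint s (arcParam s j t).1 (arcParam s j t).2

theorem cremonaVec_arcPoint_ne_zero (s : Fin 2) (j : Fin 3) (t : ℝ) :
    cremonaVec (arcPoint s j t) ≠ 0 :=
  cremonaVec_cubicPoint_ne_zero s (arcParam_ne_zero s j t)

theorem arcSign_ne_zero (s : Fin 2) : arcSign s ≠ 0 := by
  fin_cases s <;> simp [arcSign]

theorem arcPoint_ne_zero (s : Fin 2) (j : Fin 3) {t : ℝ} (h0 : 0 < t) (h1 : t < 1) (i : Fin 3) :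
    arcPoint s j t i ≠ 0 := by
  have hs := arcSign_ne_zero s
  have hh := arcSign_sq s
  have key : (arcParam s j t).2 ≠ 0 ∧ (arcParam s j t).1 ≠ arcSign s * (arcParam s j t).2 ∧
      (arcParam s j t).1 ≠ -(arcSign s * (arcParam s j t).2) := by
    fin_cases j <;> simp only [arcParam, Fin.zero_eta, Fin.mk_one, Fin.reduceFinMk, Matrix.cons_val,
      ← mul_assoc, hh]
    · exact ⟨mul_ne_zero hs h0.ne', by linarith, by linarith⟩
    · refine ⟨one_ne_zero, fun h => ?_, fun h => ?_⟩
      · have := mul_left_cancel₀ hs h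
        linarith
      · have := mul_left_cancel₀ hs (h.trans (mul_neg _ _).symm)
        linarith
    · exact ⟨mul_ne_zero hs (by linarith), by linarith, by linarith⟩
  fin_cases i
  · exact mt (cubicPoint_zero_eq_zero (arcParam_ne_zero s j t)).1 key.1
  · exact mt (cubicPoint_one_eq_zero (arcParam_ne_zero s j t)).1 key.2.1
  · exact mt (cubicPoint_two_eq_zero (arcParam_ne_zero s j t)).1 key.2.2

/-- The three arcs of a component use disjoint sets of slopes p/q: beyond 1 in absolute value with
the sign of `arcSign s`, between -1 and 1, and beyond 1 with the opposite sign. Within each set the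
slope is strictly monotone in t. -/
theorem arcParam_injective {s : Fin 2} {j j' : Fin 3} {t t' : ℝ} (h0 : 0 < t) (h1 : t < 1)
    (h0' : 0 < t') (h1' : t' < 1)
    (h : (arcParam s j t).1 * (arcParam s j' t').2 = (arcParam s j' t').1 * (arcParam s j t).2) :
    j = j' ∧ t = t' := by
  have hs := arcSign_ne_zero s
  have hh := arcSign_sq s
  have hc : ∀ {x y : ℝ}, arcSign s * x = arcSign s * y → x = y := fun h => mul_left_cancel₀ hs h
  have aux : ∀ {x y : ℝ}, 0 < x → x < 1 → 0 < y → y < 1 → x * (1 - 2 * y) < 1 ∧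
      -1 < x * (1 - 2 * y) := fun hx hx' hy hy' => by constructor <;> nlinarith
  fin_cases j <;> fin_cases j' <;>
    simp only [arcParam, Fin.zero_eta, Fin.mk_one, Fin.reduceFinMk, Matrix.cons_val] at h ⊢
  · exact ⟨trivial, (hc (by linarith)).symm⟩
  · have := aux h0 h1 h0' h1'
    nlinarith
  · have := hc (x := t' - 1) (y := t) (by linarith)
    linarith
  · have := aux h0' h1' h0 h1
    nlinarith
  · have := hc (x := 1 - 2 * t) (y := 1 - 2 * t') (by linarith)
    exact ⟨trivial, by linarith⟩
  · have := aux (x := 1 - t') (by linarith) (by linarith) h0 h1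
    nlinarith
  · have := hc (x := t') (y := t - 1) (by linarith)
    linarith
  · have := aux (x := 1 - t) (by linarith) (by linarith) h0' h1'
    nlinarith
  · have := hc (x := t' - 1) (y := t - 1) (by linarith)
    exact ⟨trivial, by linarith⟩

theorem exists_arcParam (s : Fin 2) {p q : ℝ} (hq : q ≠ 0) (h1 : p ≠ q) (h2 : p ≠ -q) :
    ∃ (j : Fin 3) (t r : ℝ), 0 < t ∧ t < 1 ∧ r ≠ 0 ∧
      p = r * (arcParam s j t).1 ∧ q = r * (arcParam s j t).2 := by
  have hh := arcSign_sq s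
  have hs : arcSign s = 1 ∨ arcSign s = -1 := by fin_cases s <;> simp [arcSign]
  rcases lt_or_ge |p| |q| with h | h
  · have hpq : |arcSign s * (p / q)| < 1 := by
      have : |arcSign s| = 1 := by rcases hs with e | e <;> simp [e]
      rw [abs_mul, this, one_mul, abs_div, div_lt_one (abs_pos.2 hq)]
      exact h
    rw [abs_lt] at hpq
    refine ⟨1, (1 - arcSign s * (p / q)) / 2, q, by linarith, by linarith, hq, ?_, ?_⟩
    · have : p = q * (arcSign s * arcSign s * (p / q)) := by rw [hh]; field_simp
      simp only [arcParam, Matrix.cons_val]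
      linear_combination this
    · simp [arcParam]
  · have hp : p ≠ 0 := by
      rintro rfl
      simp [hq] at h
    have hlt : |q| < |p| := lt_of_le_of_ne h fun e => by
      rcases abs_eq_abs.1 e with e | e
      · exact h1 e.symm
      · exact h2 (by linarith)
    have hpq : |arcSign s * (q / p)| < 1 := by
      have : |arcSign s| = 1 := by rcases hs with e | e <;> simp [e]
      rw [abs_mul, this, one_mul, abs_div, div_lt_one (abs_pos.2 hp)]
      exact hlt
    rw [abs_lt] at hpq
    have hq' : q = p * (arcSign s * arcSign s * (q / p)) := by rw [hh]; field_simp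
    have hne : arcSign s * (q / p) ≠ 0 := by
      have := arcSign_ne_zero s
      positivity
    rcases lt_or_gt_of_ne hne with hu | hu
    · refine ⟨2, 1 + arcSign s * (q / p), p, by linarith, by linarith, hp, by simp [arcParam], ?_⟩
      simp only [arcParam, Matrix.cons_val]
      linear_combination hq'
    · refine ⟨0, arcSign s * (q / p), p, by linarith, by linarith, hp, by simp [arcParam], ?_⟩
      simp only [arcParam, Matrix.cons_val]
      linear_combination hq'

/-- The six arcs of the real curve. -/
noncomputable def curveArc (j : Fin 3) (s : Fin 2) :
    Path (coordPoint ℝ j) (coordPoint ℝ (j + 1)) where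
  toFun t := Projectivization.mk ℝ (cremonaVec (arcPoint s j t)) (cremonaVec_arcPoint_ne_zero s j t)
  continuous_toFun := by
    refine continuous_mk_projPlane ?_ _
    have h : Continuous fun t : unitInterval => arcPoint s j t :=
      (continuous_cubicPoint s).comp ((continuous_arcParam s j).comp continuous_subtype_val)
    refine continuous_pi fun i => ?_
    fin_cases i <;> simp only [cremonaVec, Fin.zero_eta, Fin.mk_one, Fin.reduceFinMk,
      Matrix.cons_val] <;> fun_prop
  source' := by
    rw [mk_cremonaVec_eq_coordPoint]
    have h := arcParam_ne_zero s j 0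
    fin_cases j
    · exact (cubicPoint_zero_eq_zero h).2 (by simp [arcParam])
    · exact (cubicPoint_one_eq_zero h).2 (by simp [arcParam])
    · exact (cubicPoint_two_eq_zero h).2 (by simp [arcParam, arcSign_sq])
  target' := by
    rw [mk_cremonaVec_eq_coordPoint]
    have h := arcParam_ne_zero s j 1
    fin_cases j
    · exact (cubicPoint_one_eq_zero h).2 (by simp [arcParam, arcSign_sq])
    · exact (cubicPoint_two_eq_zero h).2 (by simp [arcParam]; ring)
    · exact (cubicPoint_zero_eq_zero h).2 (by simp [arcParam])

theorem curveArc_apply (j : Fin 3) (s : Fin 2) (t : unitInterval) :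
    curveArc j s t = Projectivization.mk ℝ (cremonaVec (arcPoint s j t))
      (cremonaVec_arcPoint_ne_zero s j t) := rfl

theorem curveArc_ne_coordPoint (j : Fin 3) (s : Fin 2) {t : unitInterval}
    (ht : t ∈ Set.Ioo (0 : unitInterval) 1) (i : Fin 3) : curveArc j s t ≠ coordPoint ℝ i := by
  rw [curveArc_apply, Ne, mk_cremonaVec_eq_coordPoint]
  exact arcPoint_ne_zero s j ht.1 ht.2 i

/-- Interior points lie off the triangle, where the involution can be undone. The point of the cubic
then determines component and slope, hence s, j and t. -/
theorem curveArc_eq_curveArc {j j' : Fin 3} {s s' : Fin 2} {t t' : unitInterval}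
    (ht : t ∈ Set.Ioo (0 : unitInterval) 1) (ht' : t' ∈ Set.Ioo (0 : unitInterval) 1)
    (h : curveArc j s t = curveArc j' s' t') : j = j' ∧ s = s' ∧ t = t' := by
  have hne := arcPoint_ne_zero s j (t := t) ht.1 ht.2
  obtain ⟨r, hr⟩ := exists_smul_eq_of_mk_cremonaVec_eq _ _ h
    (mul_ne_zero (mul_ne_zero (hne 0) (hne 1)) (hne 2))
  have hq : (arcParam s j t).2 ≠ 0 :=
    fun h0 => hne 0 ((cubicPoint_zero_eq_zero (arcParam_ne_zero s j t)).2 h0)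
  obtain ⟨rfl, h2⟩ := cubicPoint_injective (arcParam_ne_zero s j t) (arcParam_ne_zero s' j' t') hq hr
  obtain ⟨h3, h4⟩ := arcParam_injective ht.1 ht.2 ht'.1 ht'.2 h2
  exact ⟨h3, rfl, Subtype.ext h4⟩

theorem coordPoint_injective (k : Type*) [Field k] : Function.Injective (coordPoint k) := by
  intro i j h
  by_contra hne
  have := (mk_eq_coordPoint _ j).1 h i hne
  simp at this

theorem curveArc_injective (j : Fin 3) (s : Fin 2) : Function.Injective (curveArc j s) := by
  have hends : ∀ t : unitInterval, t = 0 ∨ t = 1 ∨ t ∈ Set.Ioo (0 : unitInterval) 1 := by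
    intro t
    rcases eq_or_ne t 0 with h | h
    · exact Or.inl h
    rcases eq_or_ne t 1 with h' | h'
    · exact Or.inr (Or.inl h')
    exact Or.inr (Or.inr ⟨unitInterval.pos_iff_ne_zero.2 h, unitInterval.lt_one_iff_ne_one.2 h'⟩)
  have hj : coordPoint ℝ j ≠ coordPoint ℝ (j + 1) := fun h => by
    have := coordPoint_injective ℝ h
    fin_cases j <;> simp at this
  intro t t' h
  rcases hends t with rfl | rfl | ht <;> rcases hends t' with rfl | rfl | ht'
  · rfl
  · rw [Path.source, Path.target] at h
    exact absurd h hj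
  · rw [Path.source] at h
    exact absurd h.symm (curveArc_ne_coordPoint j s ht' j)
  · rw [Path.source, Path.target] at h
    exact absurd h.symm hj
  · rfl
  · rw [Path.target] at h
    exact absurd h.symm (curveArc_ne_coordPoint j s ht' _)
  · rw [Path.source] at h
    exact absurd h (curveArc_ne_coordPoint j s ht j)
  · rw [Path.target] at h
    exact absurd h (curveArc_ne_coordPoint j s ht _)
  · exact (curveArc_eq_curveArc ht ht' h).2.2

theorem iUnion_range_curveArc : (⋃ j, ⋃ s, Set.range (curveArc j s)) = curveV ℝ := by
  ext x
  simp only [Set.mem_iUnion, Set.mem_range]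
  constructor
  · rintro ⟨j, s, t, rfl⟩
    rw [curveArc_apply]
    exact mk_cremonaVec_mem_curveV _ (cubicPoint_mem s _ _)
  induction x using Projectivization.ind with | h v hv
  intro hx
  have hQ := (mk_mem_curveV hv).1 hx
  by_cases h0 : v 0 * v 1 * v 2 = 0
  · have := (mk_mem_coordPoints hv).2 (mul_eq_zero_of_eval_sexticQ_eq_zero hQ h0)
    have h : ∃ i, Projectivization.mk ℝ v hv = coordPoint ℝ i := by
      rcases this with h | h | h
      exacts [⟨0, h⟩, ⟨1, h⟩, ⟨2, h⟩]
    obtain ⟨i, hi⟩ := h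
    -- The i-th vertex is the starting point of the arcs with index i; either component would do.
    exact ⟨i, 0, 0, by rw [Path.source, hi]⟩
  set u := cremonaVec v with hu
  have hu0 : ∀ i, u i ≠ 0 := by
    simp only [mul_eq_zero, not_or] at h0
    intro i
    fin_cases i <;> simp [hu, cremonaVec, h0]
  obtain ⟨s, r, hr⟩ := exists_cubicPoint (cremonaCubic_cremonaVec_eq_zero hQ) (hu0 0)
  have hpq : -(u 1 + u 2) ≠ 0 ∨ u 0 ≠ 0 := Or.inr (hu0 0)
  have hr0 : r ≠ 0 := by
    rintro rfl
    exact cubicPoint_ne_zero s hpq (by simpa using hr)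
  have hc : ∀ i, cubicPoint s (-(u 1 + u 2)) (u 0) i ≠ 0 := fun i => by
    rw [hr]
    exact mul_ne_zero hr0 (hu0 i)
  have n1 := mt (cubicPoint_one_eq_zero hpq).2 (hc 1)
  have n2 := mt (cubicPoint_two_eq_zero hpq).2 (hc 2)
  obtain ⟨j, t, ρ, ht0, ht1, hρ, ep, eq⟩ := exists_arcParam s (p := -(u 1 + u 2)) (hu0 0)
    (by fin_cases s <;> simp [arcSign] at n1 n2 ⊢ <;> assumption)
    (by fin_cases s <;> simp [arcSign] at n1 n2 ⊢ <;> assumption)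
  obtain ⟨c, hcc⟩ := cubicPoint_smul s hρ (arcParam_ne_zero s j t)
  rw [← ep, ← eq, hr] at hcc
  refine ⟨j, s, ⟨t, ht0.le, ht1.le⟩, ?_⟩
  rw [curveArc_apply, Projectivization.mk_eq_mk_iff']
  have e : cremonaVec (r • u) = c ^ 2 • cremonaVec (arcPoint s j t) := by
    rw [hcc, cremonaVec_smul]
    rfl
  rw [cremonaVec_smul, hu, cremonaVec_cremonaVec, smul_smul] at e
  have hc0 : c ≠ 0 := by
    rintro rfl
    rw [zero_smul] at hcc
    exact mul_ne_zero hr0 (hu0 0) (congrFun hcc 0)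
  refine ⟨(c ^ 2)⁻¹ * (r ^ 2 * (v 0 * v 1 * v 2)), ?_⟩
  rw [mul_smul, e, smul_smul, inv_mul_cancel₀ (pow_ne_zero 2 hc0), one_smul]

theorem disjoint_curveArc {j j' : Fin 3} {s s' : Fin 2} (h : (j, s) ≠ (j', s')) :
    Disjoint (curveArc j s '' Set.Ioo 0 1) (curveArc j' s' '' Set.Ioo 0 1) := by
  rw [Set.disjoint_left]
  rintro _ ⟨t, ht, rfl⟩ ⟨t', ht', e⟩
  obtain ⟨rfl, rfl, -⟩ := curveArc_eq_curveArc ht' ht e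
  exact h rfl

/-! ### Existence of the spaces `N³(K, L, M)` -/

/-- Generalized cosine and sine: `S' = C`, `C' = -k S`, `C² + k S² = 1`. -/
theorem exists_generalized_trig (k : ℝ) : ∃ C S : ℝ → ℝ, ContDiff ℝ ∞ C ∧ ContDiff ℝ ∞ S ∧
    (∀ x, HasDerivAt C (-k * S x) x) ∧ (∀ x, HasDerivAt S (C x) x) ∧
    ∀ x, C x ^ 2 + k * S x ^ 2 = 1 := by
  rcases lt_trichotomy k 0 with hk | rfl | hk
  · have hr : 0 < √(-k) := Real.sqrt_pos.2 (by linarith)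
    have hr2 : √(-k) ^ 2 = -k := Real.sq_sqrt (by linarith)
    have hd : ∀ x, HasDerivAt (fun x => √(-k) * x) √(-k) x := fun x => by
      simpa using (hasDerivAt_id x).const_mul √(-k)
    refine ⟨fun x => Real.cosh (√(-k) * x), fun x => Real.sinh (√(-k) * x) / √(-k),
      by fun_prop, by fun_prop, fun x => ?_, fun x => ?_, fun x => ?_⟩
    · refine (hd x).cosh.congr_deriv ?_
      field_simp
      rw [hr2]
      ring
    · exact ((hd x).sinh.div_const √(-k)).congr_deriv (by field_simp)
    · have := Real.cosh_sq (√(-k) * x)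
      have hk0 : k ≠ 0 := hk.ne
      have e : k * (Real.sinh (√(-k) * x) ^ 2 / -k) = -Real.sinh (√(-k) * x) ^ 2 := by field_simp
      rw [div_pow, hr2, e]
      linarith
  · exact ⟨fun _ => 1, fun x => x, by fun_prop, by fun_prop,
      fun x => by simpa using hasDerivAt_const x (1 : ℝ), fun x => hasDerivAt_id x, fun x => by simp⟩
  · have hr : 0 < √k := Real.sqrt_pos.2 hk
    have hr2 : √k ^ 2 = k := Real.sq_sqrt hk.le
    have hd : ∀ x, HasDerivAt (fun x => √k * x) √k x := fun x => by
      simpa using (hasDerivAt_id x).const_mul √k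
    refine ⟨fun x => Real.cos (√k * x), fun x => Real.sin (√k * x) / √k,
      by fun_prop, by fun_prop, fun x => ?_, fun x => ?_, fun x => ?_⟩
    · refine (hd x).cos.congr_deriv ?_
      field_simp
      rw [hr2]
      ring
    · exact ((hd x).sin.div_const √k).congr_deriv (by field_simp)
    · have := Real.sin_sq_add_cos_sq (√k * x)
      rw [div_pow, hr2]
      field_simp
      linarith

/-- Reparametrized generalized cosine and sine, with a cosine that vanishes nowhere. -/
theorem exists_generalized_trig_ne_zero (k : ℝ) : ∃ p q h : ℝ → ℝ,
    ContDiff ℝ ∞ p ∧ ContDiff ℝ ∞ q ∧ ContDiff ℝ ∞ h ∧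
    (∀ x, HasDerivAt p (-k * h x * q x) x) ∧ (∀ x, HasDerivAt q (h x * p x) x) ∧
    (∀ x, p x ≠ 0) ∧ ∀ x, h x ≠ 0 := by
  rcases le_or_gt k 0 with hk | hk
  · obtain ⟨C, S, hC, hS, hC', hS', h1⟩ := exists_generalized_trig k
    refine ⟨C, S, fun _ => 1, hC, hS, contDiff_const, by simpa using hC', by simpa using hS',
      fun x h0 => ?_, fun _ => one_ne_zero⟩
    have := h1 x
    rw [h0] at this
    nlinarith [sq_nonneg (S x)]
  · have hr : 0 < √k := Real.sqrt_pos.2 hk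
    have hr2 : √k ^ 2 = k := Real.sq_sqrt hk.le
    have hc : ∀ x, Real.cosh x ≠ 0 := fun x => (Real.cosh_pos x).ne'
    -- For k > 0 the interval |√k θ| < π/2, on which cos(√k θ) is positive, is stretched to ℝ by the
    -- Gudermannian: √k θ = gd x. Then cos(√k θ) = 1/cosh x, sin(√k θ) = tanh x, and h = dθ/dx.
    refine ⟨fun x => (Real.cosh x)⁻¹, fun x => Real.sinh x / Real.cosh x / √k,
      fun x => (Real.cosh x)⁻¹ / √k, Real.contDiff_cosh.inv hc,
      (Real.contDiff_sinh.div Real.contDiff_cosh hc).div_const _,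
      (Real.contDiff_cosh.inv hc).div_const _, fun x => ?_, fun x => ?_,
      fun x => inv_ne_zero (hc x), fun x => div_ne_zero (inv_ne_zero (hc x)) hr.ne'⟩
    · have := hc x
      refine ((Real.hasDerivAt_cosh x).fun_inv (hc x)).congr_deriv ?_
      field_simp
      rw [hr2]
    · have := hc x
      refine (((Real.hasDerivAt_sinh x).fun_div (Real.hasDerivAt_cosh x) (hc x)).div_const
        √k).congr_deriv ?_
      field_simp
      rw [Real.cosh_sq]
      ring

/-- The coordinate 1-form `dxᵢ`. -/
noncomputable abbrev coordForm (i : Fin 3) : E3 →L[ℝ] ℝ := EuclideanSpace.proj i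

/-- A 1-form with coefficients depending on the last two coordinates, in separated form. -/
noncomputable def separatedForm (A₀ B₀ A₁ B₁ : ℝ → ℝ) (r : ℝ) (y : E3) : E3 →L[ℝ] ℝ :=
  (A₀ (y 2) * B₀ (y 1)) • coordForm 0 + (A₁ (y 2) * B₁ (y 1)) • coordForm 1 + r • coordForm 2

theorem separatedForm_apply (A₀ B₀ A₁ B₁ : ℝ → ℝ) (r : ℝ) (y v : E3) :
    separatedForm A₀ B₀ A₁ B₁ r y v =
      A₀ (y 2) * B₀ (y 1) * v 0 + A₁ (y 2) * B₁ (y 1) * v 1 + r * v 2 := by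
  simp [separatedForm]

theorem contDiff_separatedForm {A₀ B₀ A₁ B₁ : ℝ → ℝ} (hA₀ : ContDiff ℝ ∞ A₀)
    (hB₀ : ContDiff ℝ ∞ B₀) (hA₁ : ContDiff ℝ ∞ A₁) (hB₁ : ContDiff ℝ ∞ B₁) (r : ℝ) :
    ContDiff ℝ ∞ (separatedForm A₀ B₀ A₁ B₁ r) := by
  have h1 : ContDiff ℝ ∞ fun y : E3 => y 1 := (coordForm 1).contDiff
  have h2 : ContDiff ℝ ∞ fun y : E3 => y 2 := (coordForm 2).contDiff
  unfold separatedForm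
  exact ((((hA₀.comp h2).mul (hB₀.comp h1)).smul contDiff_const).add
    (((hA₁.comp h2).mul (hB₁.comp h1)).smul contDiff_const)).add contDiff_const

theorem dForm_separatedForm {A₀ B₀ A₁ B₁ : ℝ → ℝ} {a₀ b₀ a₁ b₁ : ℝ} {y : E3}
    (hA₀ : HasDerivAt A₀ a₀ (y 2)) (hB₀ : HasDerivAt B₀ b₀ (y 1))
    (hA₁ : HasDerivAt A₁ a₁ (y 2)) (hB₁ : HasDerivAt B₁ b₁ (y 1)) (r : ℝ) (v w : E3) :
    dForm (separatedForm A₀ B₀ A₁ B₁ r) y v w =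
      a₀ * B₀ (y 1) * (v 2 * w 0 - w 2 * v 0) + A₀ (y 2) * b₀ * (v 1 * w 0 - w 1 * v 0)
        + a₁ * B₁ (y 1) * (v 2 * w 1 - w 2 * v 1) := by
  have h1 : HasFDerivAt (fun y : E3 => y 1) (coordForm 1) y := (coordForm 1).hasFDerivAt
  have h2 : HasFDerivAt (fun y : E3 => y 2) (coordForm 2) y := (coordForm 2).hasFDerivAt
  have H := ((((hA₀.comp_hasFDerivAt y h2).mul (hB₀.comp_hasFDerivAt y h1)).smul_const
    (coordForm 0)).add (((hA₁.comp_hasFDerivAt y h2).mul (hB₁.comp_hasFDerivAt y h1)).smul_const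
    (coordForm 1))).add_const (r • coordForm 2)
  have H' : HasFDerivAt (separatedForm A₀ B₀ A₁ B₁ r) _ y := H
  rw [dForm, H'.fderiv]
  simp
  ring

/-- The equations read dσ¹ = a σ²∧σ³, dσ² = b σ³∧σ¹, dσ³ = c σ¹∧σ². In coordinates (x,y,z) of ℝ³
they are solved by σ³ = dz - c q(y) dx and by turning the pair (p(y) dx, h(y) dy) through a
generalized rotation in z with parameter ab. The determinant of the coframe is p h, which is why p
and h must vanish nowhere; as completeness is not required, stretching y is harmless. -/
theorem nonempty_spaceN3 (K L M : ℝ) : Nonempty (SpaceN3 K L M) := by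
  set a := L - K with ha
  set b := -(M + K) with hb
  set c := L - M with hc
  obtain ⟨C, S, hC, hS, hC', hS', h1⟩ := exists_generalized_trig (a * b)
  obtain ⟨p, q, h, hp, hq, hh, hp', hq', hp0, hh0⟩ := exists_generalized_trig_ne_zero (a * c)
  have hdiff : ∀ {f : ℝ → ℝ}, ContDiff ℝ ∞ f → ∀ x, HasDerivAt f (deriv f x) x := fun hf x =>
    (hf.differentiable (by simp) x).hasDerivAt
  let σ : Fin 3 → E3 → E3 →L[ℝ] ℝ :=
    ![separatedForm C p (fun x => -a * S x) h 0, separatedForm (fun x => b * S x) p C h 0,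
      separatedForm (fun _ => -c) q (fun _ => 0) (fun _ => 0) 1]
  have hσ : IsStructureCoframe K L M Set.univ σ := by
    refine ⟨fun i => ?_, fun y _ => ?_, fun y _ v w => ?_, fun y _ v w => ?_, fun y _ v w => ?_⟩
    · apply ContDiff.contDiffOn
      fin_cases i
      · exact contDiff_separatedForm hC hp (contDiff_const.mul hS) hh 0
      · exact contDiff_separatedForm (contDiff_const.mul hS) hp hC hh 0
      · exact contDiff_separatedForm contDiff_const hq contDiff_const contDiff_const 1
    · rw [Fintype.linearIndependent_iff]
      intro g hg
      have hv : ∀ v : E3, g 0 * σ 0 y v + g 1 * σ 1 y v + g 2 * σ 2 y v = 0 := fun v => by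
        have := congrArg (fun f : E3 →L[ℝ] ℝ => f v) hg
        simpa [Fin.sum_univ_three] using this
      have e0 := hv (EuclideanSpace.single 0 1)
      have e1 := hv (EuclideanSpace.single 1 1)
      have e2 := hv (EuclideanSpace.single 2 1)
      simp [σ, separatedForm_apply] at e0 e1 e2
      have e0' : g 0 * C (y 2) + g 1 * (b * S (y 2)) = 0 :=
        mul_right_cancel₀ (hp0 (y 1)) (by rw [e2] at e0; linear_combination e0)
      have e1' : -(g 0 * (a * S (y 2))) + g 1 * C (y 2) = 0 :=
        mul_right_cancel₀ (hh0 (y 1)) (by linear_combination e1)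
      have h1 := h1 (y 2)
      intro i
      fin_cases i
      · change g 0 = 0
        linear_combination C (y 2) * e0' - b * S (y 2) * e1' - g 0 * h1
      · change g 1 = 0
        linear_combination a * S (y 2) * e0' + C (y 2) * e1' - g 1 * h1
      · exact e2
    · have := dForm_separatedForm (y := y) (hC' _) (hp' _) ((hS' _).const_mul (-a))
        (hdiff hh _) 0 v w
      simp only [σ, wedge, Matrix.cons_val, separatedForm_apply, this]
      ring
    · have := dForm_separatedForm (y := y) ((hS' _).const_mul b) (hp' _) (hC' _)
        (hdiff hh _) 0 v w
      have hMK : M + K = -b := by rw [hb, neg_neg]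
      simp only [σ, wedge, Matrix.cons_val, separatedForm_apply, this, hMK]
      ring
    · have := dForm_separatedForm (y := y) (hasDerivAt_const _ (-c)) (hq' _)
        (hasDerivAt_const _ 0) (hasDerivAt_const _ 0) 1 v w
      simp only [σ, wedge, Matrix.cons_val, separatedForm_apply, this]
      -- Here σ¹∧σ² = (C² + ab S²) p h dx∧dy, and C² + ab S² = 1.
      linear_combination -c * p (y 1) * h (y 1) * (v 0 * w 1 - v 1 * w 0) * h1 (y 2)
  refine ⟨{ carrier := E3, σ := fun a x => σ a x, structureEqs := fun e he => ?_ }⟩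
  rw [chartedSpaceSelf_atlas] at he
  subst he
  have e : (fun (a : Fin 3) (y : E3) =>
      (σ a ((OpenPartialHomeomorph.refl E3).symm y)).comp
        (mfderiv 𝓘(ℝ, E3) (𝓡 3) (OpenPartialHomeomorph.refl E3).symm y)) = σ := by
    funext a y
    have : mfderiv 𝓘(ℝ, E3) (𝓡 3) (OpenPartialHomeomorph.refl E3).symm y =
        ContinuousLinearMap.id ℝ E3 := mfderiv_id
    rw [this]
    rfl
  rw [← e] at hσ
  exact hσ

/-! ### Curvature of a metric given by a structure coframe -/

section PartialDerivatives
variable {f g : E3 → ℝ} {y : E3}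

theorem partialD_congr (i : Fin 3) (h : f =ᶠ[nhds y] g) : partialD i f y = partialD i g y := by
  rw [partialD, partialD, h.fderiv_eq]

theorem partialD_add (i : Fin 3) (hf : DifferentiableAt ℝ f y) (hg : DifferentiableAt ℝ g y) :
    partialD i (fun x => f x + g x) y = partialD i f y + partialD i g y := by
  simp [partialD, fderiv_fun_add hf hg]

theorem partialD_mul (i : Fin 3) (hf : DifferentiableAt ℝ f y) (hg : DifferentiableAt ℝ g y) :
    partialD i (fun x => f x * g x) y = partialD i f y * g y + f y * partialD i g y := by
  simp [partialD, fderiv_fun_mul hf hg]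
  ring

theorem partialD_const_mul (i : Fin 3) (c : ℝ) (hf : DifferentiableAt ℝ f y) :
    partialD i (fun x => c * f x) y = c * partialD i f y := by
  simp [partialD, fderiv_const_mul hf]

theorem partialD_sum {ι : Type*} [Fintype ι] (i : Fin 3) {f : ι → E3 → ℝ}
    (hf : ∀ a, DifferentiableAt ℝ (f a) y) :
    partialD i (fun x => ∑ a, f a x) y = ∑ a, partialD i (f a) y := by
  simp [partialD, fderiv_fun_sum fun a _ => hf a]

theorem ContDiffAt.partialD_of_infty (i : Fin 3) (hf : ContDiffAt ℝ ∞ f y) :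
    ContDiffAt ℝ ∞ (partialD i f) y :=
  (hf.fderiv_right (m := ∞) (by simp)).clm_apply contDiffAt_const

theorem partialD_comm (i j : Fin 3) (hf : ContDiffAt ℝ ∞ f y) :
    partialD i (partialD j f) y = partialD j (partialD i f) y := by
  have hs : IsSymmSndFDerivAt ℝ f y :=
    hf.isSymmSndFDerivAt (by
      rw [minSmoothness_of_isRCLikeNormedField]
      exact WithTop.coe_le_coe.2 (le_top : (2 : ℕ∞) ≤ ⊤))
  have hd : DifferentiableAt ℝ (fderiv ℝ f) y :=
    (hf.fderiv_right (m := ∞) (by simp)).differentiableAt (by simp)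
  have key : ∀ i j : Fin 3, partialD i (partialD j f) y =
      fderiv ℝ (fderiv ℝ f) y (EuclideanSpace.single i 1) (EuclideanSpace.single j 1) := by
    intro i j
    change fderiv ℝ (fun x => fderiv ℝ f x (EuclideanSpace.single j 1)) y _ = _
    rw [fderiv_clm_apply hd (differentiableAt_const _)]
    simp
  rw [key, key]
  exact hs _ _

end PartialDerivatives

/-- The inverse of a matrix of differentiable functions has differentiable entries. -/
theorem DifferentiableAt.matrix_inv_apply {E n : Type*} [NormedAddCommGroup E] [NormedSpace ℝ E]
    [Fintype n] [DecidableEq n] {A : E → Matrix n n ℝ} {y : E}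
    (hA : ∀ i j, DifferentiableAt ℝ (fun x => A x i j) y) (h0 : (A y).det ≠ 0) (i j : n) :
    DifferentiableAt ℝ (fun x => (A x)⁻¹ i j) y := by
  have hdet : ∀ {B : E → Matrix n n ℝ}, (∀ i j, DifferentiableAt ℝ (fun x => B x i j) y) →
      DifferentiableAt ℝ (fun x => (B x).det) y := by
    intro B hB
    simp only [Matrix.det_apply]
    refine DifferentiableAt.fun_sum fun τ _ => DifferentiableAt.fun_const_smul ?_ _
    have := (HasFDerivAt.finsetProd (u := Finset.univ) fun i _ =>
      (hB (τ i) i).hasFDerivAt).differentiableAt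
    exact this.congr_of_eventuallyEq (.of_eq (by ext x; simp))
  simp only [Matrix.inv_def, Ring.inverse_eq_inv', Matrix.smul_apply, smul_eq_mul,
    Matrix.adjugate_apply]
  refine ((hdet hA).fun_inv h0).fun_mul (hdet fun a b => ?_)
  simp only [Matrix.updateRow_apply]
  split_ifs
  · exact differentiableAt_const _
  · exact hA a b

/-- The matrix of components of a coframe. -/
noncomputable def coframeMatrix (σ : Fin 3 → E3 → E3 →L[ℝ] ℝ) (y : E3) : Matrix (Fin 3) (Fin 3) ℝ :=
  Matrix.of fun a i => σ a y (EuclideanSpace.single i 1)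

theorem coframeMetric_eq (σ : Fin 3 → E3 → E3 →L[ℝ] ℝ) (y : E3) :
    coframeMetric σ y = (coframeMatrix σ y).transpose * coframeMatrix σ y := by
  ext i j
  simp [coframeMetric, coframeMatrix, Matrix.mul_apply]

/-- The matrices of the Levi-Civita connection form of `N³(K, L, M)` in the given coframe,
evaluated on the `i`-th coordinate vector. -/
def connectionMatrix (K L M : ℝ) (S : Matrix (Fin 3) (Fin 3) ℝ) (i : Fin 3) :
    Matrix (Fin 3) (Fin 3) ℝ :=
  !![0, -K * S 2 i, -L * S 1 i; K * S 2 i, 0, -M * S 0 i; L * S 1 i, M * S 0 i, 0]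

namespace IsStructureCoframe
variable {K L M : ℝ} {U : Set E3} {σ : Fin 3 → E3 → E3 →L[ℝ] ℝ}

theorem contDiffAt_apply (h : IsStructureCoframe K L M U σ) (hU : IsOpen U) {y : E3} (hy : y ∈ U)
    (a i : Fin 3) : ContDiffAt ℝ ∞ (fun x => coframeMatrix σ x a i) y :=
  ((h.smooth a).contDiffAt (hU.mem_nhds hy)).clm_apply contDiffAt_const

theorem differentiableAt_apply (h : IsStructureCoframe K L M U σ) (hU : IsOpen U) {y : E3}
    (hy : y ∈ U) (a i : Fin 3) : DifferentiableAt ℝ (fun x => coframeMatrix σ x a i) y :=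
  (h.contDiffAt_apply hU hy a i).differentiableAt (by simp)

theorem det_coframeMatrix_ne_zero (h : IsStructureCoframe K L M U σ) {y : E3} (hy : y ∈ U) :
    (coframeMatrix σ y).det ≠ 0 := by
  have hli := h.indep y hy
  rw [Fintype.linearIndependent_iff] at hli
  rw [← isUnit_iff_ne_zero, ← Matrix.isUnit_iff_isUnit_det,
    ← Matrix.linearIndependent_rows_iff_isUnit, Fintype.linearIndependent_iff]
  intro g hg
  refine hli g (ContinuousLinearMap.coe_injective
    ((EuclideanSpace.basisFun (Fin 3) ℝ).toBasis.ext fun i => ?_))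
  have := congrFun hg i
  simpa [Matrix.row, coframeMatrix] using this

theorem dForm_single (h : IsStructureCoframe K L M U σ) (hU : IsOpen U) {y : E3} (hy : y ∈ U)
    (a i j : Fin 3) :
    dForm (σ a) y (EuclideanSpace.single i 1) (EuclideanSpace.single j 1) =
      partialD i (fun x => coframeMatrix σ x a j) y
        - partialD j (fun x => coframeMatrix σ x a i) y := by
  have hd : DifferentiableAt ℝ (σ a) y :=
    ((h.smooth a).contDiffAt (hU.mem_nhds hy)).differentiableAt (by simp)
  have key : ∀ i j : Fin 3, partialD i (fun x => coframeMatrix σ x a j) y =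
      fderiv ℝ (σ a) y (EuclideanSpace.single i 1) (EuclideanSpace.single j 1) := by
    intro i j
    change fderiv ℝ (fun x => σ a x (EuclideanSpace.single j 1)) y _ = _
    rw [fderiv_clm_apply hd (differentiableAt_const _)]
    simp
  rw [key, key, dForm]

/-- These are the structure equations on coordinate vectors. They amount to dσ + ω∧σ = 0 for the
skew matrix ω of `connectionMatrix`, so that ω is the Levi-Civita connection. -/
theorem torsion_free (h : IsStructureCoframe K L M U σ) (hU : IsOpen U) {y : E3} (hy : y ∈ U)
    (i j : Fin 3) :
    let S := coframeMatrix σ y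
    (partialD i (fun x => coframeMatrix σ x 0 j) y - partialD j (fun x => coframeMatrix σ x 0 i) y
      = (L - K) * (S 1 i * S 2 j - S 1 j * S 2 i)) ∧
    (partialD i (fun x => coframeMatrix σ x 1 j) y - partialD j (fun x => coframeMatrix σ x 1 i) y
      = (M + K) * (S 0 i * S 2 j - S 0 j * S 2 i)) ∧
    (partialD i (fun x => coframeMatrix σ x 2 j) y - partialD j (fun x => coframeMatrix σ x 2 i) y
      = (L - M) * (S 0 i * S 1 j - S 0 j * S 1 i)) := by
  intro S
  rw [← h.dForm_single hU hy, ← h.dForm_single hU hy, ← h.dForm_single hU hy]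
  exact ⟨h.d1 y hy _ _, h.d2 y hy _ _, h.d3 y hy _ _⟩

/-- Koszul's formula in a structure coframe. -/
theorem sum_partialD_metric (h : IsStructureCoframe K L M U σ) (hU : IsOpen U) {y : E3} (hy : y ∈ U)
    (i j l : Fin 3) :
    partialD i (fun x => coframeMetric σ x j l) y + partialD j (fun x => coframeMetric σ x i l) y
      - partialD l (fun x => coframeMetric σ x i j) y =
    2 * ∑ c, (partialD i (fun x => coframeMatrix σ x c j) y +
      (connectionMatrix K L M (coframeMatrix σ y) i * coframeMatrix σ y) c j)
        * coframeMatrix σ y c l := by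
  have hd := h.differentiableAt_apply hU hy
  have key : ∀ l i j : Fin 3, partialD l (fun x => coframeMetric σ x i j) y =
      ∑ c, (partialD l (fun x => coframeMatrix σ x c i) y * coframeMatrix σ y c j
        + coframeMatrix σ y c i * partialD l (fun x => coframeMatrix σ x c j) y) := by
    intro l i j
    simp only [coframeMetric_eq, Matrix.mul_apply, Matrix.transpose_apply]
    rw [partialD_sum l fun c => (hd c i).fun_mul (hd c j)]
    exact Finset.sum_congr rfl fun c _ => partialD_mul l (hd c i) (hd c j)
  obtain ⟨a0, a1, a2⟩ := h.torsion_free hU hy i j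
  obtain ⟨b0, b1, b2⟩ := h.torsion_free hU hy i l
  obtain ⟨c0, c1, c2⟩ := h.torsion_free hU hy j l
  rw [key, key, key]
  simp only [Fin.sum_univ_three, connectionMatrix, Matrix.mul_apply, Matrix.of_apply,
    Matrix.cons_val]
  set S := coframeMatrix σ y
  linear_combination -S 0 l * a0 - S 1 l * a1 - S 2 l * a2 + S 0 j * b0 + S 1 j * b1 + S 2 j * b2
    + S 0 i * c0 + S 1 i * c1 + S 2 i * c2

/-- The Christoffel symbols in terms of the connection matrices. -/
theorem coframeMatrix_mul_christoffel (h : IsStructureCoframe K L M U σ) (hU : IsOpen U) {y : E3}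
    (hy : y ∈ U) (i : Fin 3) :
    coframeMatrix σ y * Matrix.of (fun k j => christoffel (coframeMetric σ) k i j y) =
      Matrix.of (fun c j => partialD i (fun x => coframeMatrix σ x c j) y) +
        connectionMatrix K L M (coframeMatrix σ y) i * coframeMatrix σ y := by
  set S := coframeMatrix σ y with hS
  have hdet : IsUnit S.det := (h.det_coframeMatrix_ne_zero hy).isUnit
  set T := Matrix.of (fun c j => partialD i (fun x => coframeMatrix σ x c j) y) +
    connectionMatrix K L M S i * S with hT
  have e : Matrix.of (fun k j => christoffel (coframeMetric σ) k i j y) =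
      (S.transpose * S)⁻¹ * (S.transpose * T) := by
    ext k j
    simp only [Matrix.of_apply, christoffel, h.sum_partialD_metric hU hy]
    rw [coframeMetric_eq]
    rw [Matrix.mul_apply, Finset.mul_sum]
    refine Finset.sum_congr rfl fun l _ => ?_
    have : (S.transpose * T) l j = ∑ c, T c j * S c l := by
      simp [Matrix.mul_apply, mul_comm]
    rw [this]
    simp only [← hS, hT, Matrix.add_apply, Matrix.of_apply]
    ring
  rw [e, Matrix.mul_inv_rev, Matrix.mul_assoc, ← Matrix.mul_assoc S, Matrix.mul_nonsing_inv _ hdet,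
    Matrix.one_mul, ← Matrix.mul_assoc, Matrix.nonsing_inv_mul _ (by rwa [Matrix.det_transpose]),
    Matrix.one_mul]

theorem differentiableAt_connectionMatrix (h : IsStructureCoframe K L M U σ) (hU : IsOpen U)
    {y : E3} (hy : y ∈ U) (i a b : Fin 3) :
    DifferentiableAt ℝ (fun x => connectionMatrix K L M (coframeMatrix σ x) i a b) y := by
  have hd := h.differentiableAt_apply hU hy
  have h0 := hd 0 i
  have h1 := hd 1 i
  have h2 := hd 2 i
  fin_cases a <;> fin_cases b <;>
    simp only [connectionMatrix, Matrix.of_apply, Matrix.cons_val, Fin.zero_eta, Fin.mk_one,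
      Fin.reduceFinMk] <;> fun_prop

/-- Differentiability is read off from Γ_i = S⁻¹(∂_i S + W_i S), valid throughout the open set U,
rather than from the definition of the Christoffel symbols. -/
theorem differentiableAt_christoffel (h : IsStructureCoframe K L M U σ) (hU : IsOpen U) {y : E3}
    (hy : y ∈ U) (k i j : Fin 3) :
    DifferentiableAt ℝ (christoffel (coframeMetric σ) k i j) y := by
  have hd := h.differentiableAt_apply hU hy
  have hev : (fun x => ∑ c, (coframeMatrix σ x)⁻¹ k c *
      (partialD i (fun x => coframeMatrix σ x c j) x +
        ∑ b, connectionMatrix K L M (coframeMatrix σ x) i c b * coframeMatrix σ x b j)) =ᶠ[nhds y]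
      christoffel (coframeMetric σ) k i j := by
    filter_upwards [hU.mem_nhds hy] with x hx
    have hdet : IsUnit (coframeMatrix σ x).det := (h.det_coframeMatrix_ne_zero hx).isUnit
    have := congrArg (fun A => ((coframeMatrix σ x)⁻¹ * A) k j)
      (h.coframeMatrix_mul_christoffel hU hx i)
    simp only [← Matrix.mul_assoc, Matrix.nonsing_inv_mul _ hdet, Matrix.one_mul] at this
    rw [Matrix.of_apply] at this
    rw [this]
    simp [Matrix.mul_apply]
  refine DifferentiableAt.congr_of_eventuallyEq ?_ hev.symm
  refine DifferentiableAt.fun_sum fun c _ => ?_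
  refine (DifferentiableAt.matrix_inv_apply hd (h.det_coframeMatrix_ne_zero hy) k c).fun_mul ?_
  refine DifferentiableAt.fun_add
    (((h.contDiffAt_apply hU hy c j).partialD_of_infty i).differentiableAt (by simp)) ?_
  exact DifferentiableAt.fun_sum fun b _ =>
    (h.differentiableAt_connectionMatrix hU hy i c b).fun_mul (hd b j)

/-- The derivative of the equation that expresses the Christoffel symbols. -/
theorem partialD_christoffel (h : IsStructureCoframe K L M U σ) (hU : IsOpen U) {y : E3}
    (hy : y ∈ U) (i j : Fin 3) :
    Matrix.of (fun c k => partialD i (fun x => coframeMatrix σ x c k) y) *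
        Matrix.of (fun k m => christoffel (coframeMetric σ) k j m y) +
      coframeMatrix σ y * Matrix.of (fun k m => partialD i (christoffel (coframeMetric σ) k j m) y) =
    Matrix.of (fun c m => partialD i (partialD j fun x => coframeMatrix σ x c m) y) +
      (Matrix.of (fun c b => partialD i
          (fun x => connectionMatrix K L M (coframeMatrix σ x) j c b) y) * coframeMatrix σ y +
        connectionMatrix K L M (coframeMatrix σ y) j *
          Matrix.of (fun b m => partialD i (fun x => coframeMatrix σ x b m) y)) := by
  have hd := h.differentiableAt_apply hU hy
  have hW := h.differentiableAt_connectionMatrix hU hy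
  have hG := h.differentiableAt_christoffel hU hy
  ext c m
  have hev : (fun x => ∑ k, coframeMatrix σ x c k * christoffel (coframeMetric σ) k j m x)
      =ᶠ[nhds y] fun x => partialD j (fun x => coframeMatrix σ x c m) x +
        ∑ b, connectionMatrix K L M (coframeMatrix σ x) j c b * coframeMatrix σ x b m := by
    filter_upwards [hU.mem_nhds hy] with x hx
    have := congrArg (fun A => A c m) (h.coframeMatrix_mul_christoffel hU hx j)
    simpa [Matrix.mul_apply] using this
  have e := partialD_congr i hev
  rw [partialD_sum i fun k => (hd c k).fun_mul (hG k j m), partialD_add i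
    (((h.contDiffAt_apply hU hy c m).partialD_of_infty j).differentiableAt (by simp))
    (DifferentiableAt.fun_sum fun b _ => (hW j c b).fun_mul (hd b m)),
    partialD_sum i fun b => (hW j c b).fun_mul (hd b m)] at e
  simp only [partialD_mul i (hd _ _) (hG _ _ _), partialD_mul i (hW _ _ _) (hd _ _),
    Finset.sum_add_distrib] at e
  simpa [Matrix.mul_apply] using e

/-- The curvature form of `N³(K, L, M)` in the given coframe. -/
theorem coframeMatrix_mul_riemannTensor (h : IsStructureCoframe K L M U σ) (hU : IsOpen U) {y : E3}
    (hy : y ∈ U) (i j : Fin 3) :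
    let S := coframeMatrix σ y
    S * Matrix.of (fun l k => riemannTensor (coframeMetric σ) l k i j y) =
      !![0, (K * M - K * L + L * M) * (S 0 i * S 1 j - S 0 j * S 1 i),
          (K * L + L * M + K * M) * (S 2 i * S 0 j - S 2 j * S 0 i);
        -(K * M - K * L + L * M) * (S 0 i * S 1 j - S 0 j * S 1 i), 0,
          (K * M - L * M + K * L) * (S 1 i * S 2 j - S 1 j * S 2 i);
        -(K * L + L * M + K * M) * (S 2 i * S 0 j - S 2 j * S 0 i),
          -(K * M - L * M + K * L) * (S 1 i * S 2 j - S 1 j * S 2 i), 0] * S := by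
  intro S
  have E1 := h.coframeMatrix_mul_christoffel hU hy
  have E2 := h.partialD_christoffel hU hy
  have hsymm : Matrix.of (fun c m => partialD i (partialD j fun x => coframeMatrix σ x c m) y) =
      Matrix.of (fun c m => partialD j (partialD i fun x => coframeMatrix σ x c m) y) := by
    ext c m
    exact partialD_comm i j (h.contDiffAt_apply hU hy c m)
  set D : Fin 3 → Matrix (Fin 3) (Fin 3) ℝ := fun i =>
    Matrix.of (fun c j => partialD i (fun x => coframeMatrix σ x c j) y) with hD
  set G : Fin 3 → Matrix (Fin 3) (Fin 3) ℝ := fun i =>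
    Matrix.of (fun k j => christoffel (coframeMetric σ) k i j y) with hG
  set W := connectionMatrix K L M S with hW
  set dG : Fin 3 → Fin 3 → Matrix (Fin 3) (Fin 3) ℝ := fun i j =>
    Matrix.of (fun k m => partialD i (christoffel (coframeMetric σ) k j m) y) with hdG
  set dW : Fin 3 → Fin 3 → Matrix (Fin 3) (Fin 3) ℝ := fun i j =>
    Matrix.of (fun c b => partialD i (fun x => connectionMatrix K L M (coframeMatrix σ x) j c b) y)
    with hdW
  have F1 : ∀ i, D i = S * G i - W i * S := fun i => eq_sub_of_add_eq (E1 i).symm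
  have F2 : ∀ i j, S * dG i j =
      Matrix.of (fun c m => partialD i (partialD j fun x => coframeMatrix σ x c m) y)
        + (dW i j * S + W j * D i) - D i * G j := fun i j =>
    eq_sub_of_add_eq ((add_comm _ _).trans (E2 i j))
  have hR : Matrix.of (fun l k => riemannTensor (coframeMetric σ) l k i j y) =
      dG i j - dG j i + (G i * G j - G j * G i) := by
    ext l k
    simp [riemannTensor, hdG, hG, Matrix.mul_apply, Finset.sum_sub_distrib]
  -- Cartan's second equation: after substitution the second derivatives of S cancel by symmetry,
  -- the mixed first-order terms cancel as well, and dω + ω∧ω remains.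
  have hF : S * Matrix.of (fun l k => riemannTensor (coframeMetric σ) l k i j y) =
      (dW i j - dW j i + (W i * W j - W j * W i)) * S := by
    rw [hR, mul_add, mul_sub, F2, F2, hsymm, F1, F1]
    noncomm_ring
  rw [hF]
  congr 1
  obtain ⟨a0, a1, a2⟩ := h.torsion_free hU hy i j
  have hd := h.differentiableAt_apply hU hy
  have hcm : ∀ (c : ℝ) (i a j : Fin 3), partialD i (fun x => c * coframeMatrix σ x a j) y =
      c * partialD i (fun x => coframeMatrix σ x a j) y := fun c i a j =>
    partialD_const_mul i c (hd a j)
  have hz : ∀ i : Fin 3, partialD i (fun _ => (0 : ℝ)) y = 0 := fun i => by simp [partialD]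
  -- The entries of dω are K, L, M times some dσᵃ, which the structure equations turn into 2×2
  -- minors of S.
  ext a b
  fin_cases a <;> fin_cases b <;>
    simp only [hdW, hW, connectionMatrix, Matrix.add_apply, Matrix.sub_apply, Matrix.mul_apply,
      Matrix.of_apply, Matrix.cons_val, Fin.sum_univ_three, hcm, hz, Fin.zero_eta, Fin.mk_one,
      Fin.reduceFinMk]
  · ring
  · linear_combination -K * a2
  · linear_combination -L * a1
  · linear_combination K * a2
  · ring
  · linear_combination -M * a0
  · linear_combination L * a1
  · linear_combination M * a0
  · ring

/-- The metric of a structure coframe is flat at a point iff at most one of `K`, `L`, `M` is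
nonzero. -/
theorem riemannTensor_eq_zero_iff (h : IsStructureCoframe K L M U σ) (hU : IsOpen U) {y : E3}
    (hy : y ∈ U) :
    (∀ l k i j, riemannTensor (coframeMetric σ) l k i j y = 0) ↔
      K * L = 0 ∧ K * M = 0 ∧ L * M = 0 := by
  have hR := h.coframeMatrix_mul_riemannTensor hU hy
  have hdet := h.det_coframeMatrix_ne_zero hy
  set S := coframeMatrix σ y
  constructor
  · intro h0
    have hc : ∀ {A : Matrix (Fin 3) (Fin 3) ℝ}, A * S = 0 → A = 0 := fun {A} e => by
      have := congrArg (· * S⁻¹) e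
      simpa only [Matrix.mul_assoc, Matrix.mul_nonsing_inv _ hdet.isUnit, Matrix.mul_one,
        Matrix.zero_mul] using this
    have h0' : ∀ i j, S * Matrix.of (fun l k => riemannTensor (coframeMetric σ) l k i j y) = 0 :=
      fun i j => by
        rw [show Matrix.of (fun l k => riemannTensor (coframeMetric σ) l k i j y) = 0 by
          ext l k; exact h0 l k i j, Matrix.mul_zero]
    have hF := fun i j => hc ((hR i j).symm.trans (h0' i j))
    have f01 : ∀ i j, (K * M - K * L + L * M) * (S 0 i * S 1 j - S 0 j * S 1 i) = 0 :=
      fun i j => congrFun (congrFun (hF i j) 0) 1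
    have f02 : ∀ i j, (K * L + L * M + K * M) * (S 2 i * S 0 j - S 2 j * S 0 i) = 0 :=
      fun i j => congrFun (congrFun (hF i j) 0) 2
    have f12 : ∀ i j, (K * M - L * M + K * L) * (S 1 i * S 2 j - S 1 j * S 2 i) = 0 :=
      fun i j => congrFun (congrFun (hF i j) 1) 2
    rw [Matrix.det_fin_three] at hdet
    -- Laplace expansion of det S along the row missing from the minors shows that the constant
    -- factor times det S vanishes; pairwise sums and differences of the three constants then give
    -- the products.
    have g01 : K * M - K * L + L * M = 0 := mul_right_cancel₀ hdet (by
      linear_combination S 2 2 * f01 0 1 + S 2 0 * f01 1 2 - S 2 1 * f01 0 2)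
    have g02 : K * L + L * M + K * M = 0 := mul_right_cancel₀ hdet (by
      linear_combination S 1 2 * f02 0 1 + S 1 0 * f02 1 2 - S 1 1 * f02 0 2)
    have g12 : K * M - L * M + K * L = 0 := mul_right_cancel₀ hdet (by
      linear_combination S 0 2 * f12 0 1 + S 0 0 * f12 1 2 - S 0 1 * f12 0 2)
    exact ⟨by linarith, by linarith, by linarith⟩
  · rintro ⟨h1, h2, h3⟩ l k i j
    have e := hR i j
    simp only [h1, h2, h3] at e
    have : Matrix.of (fun l k => riemannTensor (coframeMetric σ) l k i j y) = 0 := by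
      have := congrArg (S⁻¹ * ·) e
      simp only [← Matrix.mul_assoc, Matrix.nonsing_inv_mul _ hdet.isUnit, Matrix.one_mul] at this
      rw [this]
      have hz : (!![0, 0, 0; 0, 0, 0; 0, 0, 0] : Matrix (Fin 3) (Fin 3) ℝ) = 0 := by
        ext a b; fin_cases a <;> fin_cases b <;> rfl
      simp [hz]
    exact congrFun (congrFun this l) k

end IsStructureCoframe

/-! ### Flat spaces and the vertices. -/

theorem SpaceN3.isFlat_iff {K L M : ℝ} (N : SpaceN3 K L M) :
    N.IsFlat ↔ K * L = 0 ∧ K * M = 0 ∧ L * M = 0 := by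
  constructor
  · intro h
    -- The flatness criterion does not depend on the point, so one point suffices; a simply
    -- connected space has one.
    obtain ⟨x⟩ : Nonempty N.carrier := inferInstance
    have he := chart_mem_atlas E3 x
    exact ((N.structureEqs _ he).riemannTensor_eq_zero_iff (chartAt E3 x).open_target
      (mem_chart_target E3 x)).1 (h _ he _ (mem_chart_target E3 x))
  · intro h e he y hy
    exact ((N.structureEqs e he).riemannTensor_eq_zero_iff e.open_target hy).2 h

theorem SpaceN3.isFlat_iff_mem_coordPoints {K L M : ℝ} (h : ![K, L, M] ≠ 0) (N : SpaceN3 K L M) :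
    N.IsFlat ↔ Projectivization.mk ℝ ![K, L, M] h ∈
      ({coordPoint ℝ 0, coordPoint ℝ 1, coordPoint ℝ 2} : Set (ProjPlane ℝ)) := by
  rw [mk_mem_coordPoints, N.isFlat_iff]
  rfl

section

/-! ### A lattice with prescribed invariants -/

open UpperHalfPlane hiding I
open Complex ModularForm EisensteinSeries Filter Topology
open scoped Real ArithmeticFunction.sigma MatrixGroups

/-- The lattice `s (ℤ τ + ℤ)`. -/
noncomputable def scaledPeriodPair (τ : ℍ) (s : ℂ) (hs : s ≠ 0) : PeriodPair where
  ω₁ := s * τ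
  ω₂ := s
  indep := by
    rw [LinearIndependent.pair_iff]
    intro a b h
    have h1 : (a : ℂ) * τ + b = 0 := mul_left_cancel₀ hs (by
      rw [mul_zero, ← h]
      simp only [real_smul]
      ring)
    have h2 := congrArg Complex.im h1
    have h3 := congrArg Complex.re h1
    simp [τ.im_ne_zero] at h2 h3
    subst h2
    simpa using h3

theorem G_scaledPeriodPair (τ : ℍ) (s : ℂ) (hs : s ≠ 0) {k : ℕ} (hk : 3 ≤ k) :
    (scaledPeriodPair τ s hs).G k = (s ^ k)⁻¹ * (2 * riemannZeta k * E hk τ) := by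
  have h1 := tsum_eisSummand_eq_riemannZeta_mul_eisensteinSeries hk τ
  have h2 : E hk τ = (1 / 2 : ℂ) * eisensteinSeries (N := 1) 0 k τ := rfl
  have h3 : (scaledPeriodPair τ s hs).G k = (s ^ k)⁻¹ * ∑' v : Fin 2 → ℤ, eisSummand k v τ := by
    rw [PeriodPair.G, ← (scaledPeriodPair τ s hs).latticeEquivProd.symm.toEquiv.tsum_eq,
      ← (finTwoArrowEquiv ℤ).symm.tsum_eq, ← tsum_mul_left]
    refine tsum_congr fun x => ?_
    have := (scaledPeriodPair τ s hs).latticeEquiv_symm_apply x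
    simp only [LinearEquiv.coe_toEquiv, this, finTwoArrowEquiv_symm_apply, eisSummand,
      Matrix.cons_val, zpow_neg, zpow_natCast, ← mul_inv, ← mul_pow]
    congr 2
    simp only [scaledPeriodPair]
    ring
  rw [h3, h1, h2]
  ring

/-- The point `i eᵘ` of the upper half plane. -/
noncomputable def imagPoint (u : ℝ) : ℍ := ⟨I * Real.exp u, by simpa [-ofReal_exp] using Real.exp_pos u⟩

theorem coe_imagPoint (u : ℝ) : (imagPoint u : ℂ) = I * Real.exp u := rfl

theorem continuous_imagPoint : Continuous imagPoint := by
  rw [UpperHalfPlane.isEmbedding_coe.continuous_iff]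
  change Continuous fun u : ℝ => I * (Real.exp u : ℂ)
  fun_prop

theorem tendsto_imagPoint : Tendsto imagPoint atTop atImInfty := by
  rw [atImInfty, tendsto_comap_iff]
  refine Real.tendsto_exp_atTop.congr fun u => ?_
  simp [← UpperHalfPlane.coe_im, coe_imagPoint, -ofReal_exp]

/-- Eisenstein series take real values on the imaginary axis. -/
theorem E_imagPoint {k : ℕ} (hk : 3 ≤ k) (hk2 : Even k) (u : ℝ) :
    E hk (imagPoint u) =
      ((1 - 2 * k / bernoulli k *
        ∑' n : ℕ+, σ (k - 1) n * Real.exp (-2 * π * Real.exp u) ^ (n : ℕ) : ℝ) : ℂ) := by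
  rw [q_expansion_bernoulli hk hk2]
  have : (2 * π * I * (imagPoint u : ℂ)) = ((-2 * π * Real.exp u : ℝ) : ℂ) := by
    rw [coe_imagPoint]
    push_cast
    linear_combination 2 * π * Complex.exp u * I_mul_I
  rw [this]
  push_cast
  simp

/-- Since B₄ = -1/30 is negative, the q-expansion is 1 + 240 ∑ σ₃(n) qⁿ, with q > 0 on the imaginary
axis. -/
theorem E₄_imagPoint_pos (u : ℝ) : 0 < (E₄ (imagPoint u)).re := by
  rw [E_imagPoint _ (by decide), ofReal_re, show bernoulli 4 = -1 / 30 by decide +kernel]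
  have : 0 ≤ ∑' n : ℕ+, (σ (4 - 1) n : ℝ) * Real.exp (-2 * π * Real.exp u) ^ (n : ℕ) :=
    tsum_nonneg fun n => by positivity
  push_cast
  linarith

/-- The point i is fixed by τ ↦ -1/τ, whose weight-6 automorphy factor there is i⁶ = -1. -/
theorem E₆_I : E₆ (imagPoint 0) = 0 := by
  have h := SlashInvariantForm.slash_action_eqn'' (Γ := 𝒮ℒ) (k := 6) E₆
    (γ := Matrix.SpecialLinearGroup.mapGL ℝ ModularGroup.S) ⟨_, rfl⟩ (imagPoint 0)
  have hS : Matrix.SpecialLinearGroup.mapGL ℝ ModularGroup.S • imagPoint 0 = imagPoint 0 := by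
    change ModularGroup.S • imagPoint 0 = imagPoint 0
    rw [modular_S_smul]
    ext
    simp [coe_imagPoint]
  have hd : denom (Matrix.SpecialLinearGroup.mapGL ℝ ModularGroup.S) (imagPoint 0) = I := by
    change denom ModularGroup.S (imagPoint 0) = I
    rw [ModularGroup.denom_S]
    simp [coe_imagPoint]
  have hI : I ^ (6 : ℤ) = -1 := by
    rw [show (6 : ℤ) = ((6 : ℕ) : ℤ) by rfl, zpow_natCast, show I ^ 6 = (I ^ 2) ^ 3 by ring, I_sq]
    norm_num
  rw [hS, hd] at h
  have h' : E₆ (imagPoint 0) = -1 * E₆ (imagPoint 0) := by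
    rw [← hI]
    exact h
  linear_combination h' / 2

theorem tendsto_E_imagPoint {k : ℕ} (hk : 3 ≤ k) (hk2 : Even k) :
    Tendsto (fun u => E hk (imagPoint u)) atTop (𝓝 1) := by
  obtain ⟨c, hc, h⟩ := ModularFormClass.exp_decay_sub_atImInfty' (E hk)
  have h1 : valueAtInfty (E hk) = 1 := by
    rw [← E_qExpansion_coeff_zero hk hk2, qExpansion_coeff_zero one_pos]
    · exact ModularFormClass.analyticAt_cuspFunction_zero _ one_pos (by simp)
    · exact_mod_cast SlashInvariantFormClass.periodic_comp_ofComplex _ (by simp)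
  rw [h1] at h
  have h2 : Tendsto (fun τ : ℍ => Real.exp (-c * τ.im)) atImInfty (𝓝 0) := by
    refine Real.tendsto_exp_atBot.comp ?_
    exact (tendsto_comap : Tendsto UpperHalfPlane.im atImInfty atTop).const_mul_atTop_of_neg
      (neg_neg_of_pos hc)
  have h3 := (h.trans_tendsto h2).comp tendsto_imagPoint
  simpa using h3.add_const 1

/-- On the imaginary axis E₄ and E₆ are real. The function E₆² - κE₄³ is at most 0 at i, where E₆
vanishes, and tends to 1 - κ > 0 at the cusp, so it has a zero. -/
theorem exists_E₆_sq_eq {κ : ℝ} (h0 : 0 ≤ κ) (h1 : κ < 1) :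
    ∃ τ : ℍ, E₄ τ ≠ 0 ∧ E₆ τ ^ 2 = κ * E₄ τ ^ 3 := by
  let φ : ℝ → ℝ := fun u => (E₆ (imagPoint u)).re ^ 2 - κ * (E₄ (imagPoint u)).re ^ 3
  have hE4 : Continuous E₄ := (ModularFormClass.holo E₄).continuous
  have hE6 : Continuous E₆ := (ModularFormClass.holo E₆).continuous
  have hφ : Continuous φ := by
    have h4 := continuous_re.comp (hE4.comp continuous_imagPoint)
    have h6 := continuous_re.comp (hE6.comp continuous_imagPoint)
    exact (h6.pow 2).sub (continuous_const.mul (h4.pow 3))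
  have hlim : Tendsto φ atTop (𝓝 (1 - κ)) := by
    have h4 := (Complex.continuous_re.tendsto _).comp
      (tendsto_E_imagPoint (k := 4) (by norm_num) (by decide))
    have h6 := (Complex.continuous_re.tendsto _).comp
      (tendsto_E_imagPoint (k := 6) (by norm_num) (by decide))
    simpa using (h6.pow 2).sub ((h4.pow 3).const_mul κ)
  have hz : φ 0 ≤ 0 := by
    have := pow_pos (E₄_imagPoint_pos 0) 3
    simp only [φ, E₆_I, zero_re]
    nlinarith
  obtain ⟨u, hu, hu0⟩ := ((hlim.eventually (lt_mem_nhds (sub_pos.2 h1))).and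
    (eventually_ge_atTop 0)).exists
  obtain ⟨x, -, hx⟩ := intermediate_value_Icc hu0 hφ.continuousOn ⟨hz, hu.le⟩
  have e4 := E_imagPoint (k := 4) (by norm_num) (by decide) x
  have e6 := E_imagPoint (k := 6) (by norm_num) (by decide) x
  have hpos := E₄_imagPoint_pos x
  simp only [φ] at hx
  refine ⟨imagPoint x, fun h => ?_, ?_⟩
  · rw [h] at hpos
    simp at hpos
  · rw [e4, ofReal_re, e6, ofReal_re] at hx
    rw [e4, e6]
    exact_mod_cast sub_eq_zero.1 hx

theorem riemannZeta_six : riemannZeta 6 = π ^ 6 / 945 := by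
  have := riemannZeta_two_mul_nat (k := 3) (by norm_num)
  norm_num [show bernoulli 6 = 1 / 42 by decide +kernel, Nat.factorial] at this
  rw [this]
  ring

/-- There is a lattice for which the Weierstrass equation is `y² = 4 x³ - (16 / 3) x + 44 / 27`. -/
theorem exists_periodPair : ∃ Γ : PeriodPair, Γ.g₂ = 16 / 3 ∧ Γ.g₃ = -(44 / 27) := by
  -- From g₂ = (4π⁴/3) E₄ and g₃ = (8π⁶/27) E₆ for ℤτ + ℤ, the scale-invariant condition is E₆²/E₄³
  -- = 27 g₃²/g₂³ = 121/256. The scale s is then chosen to make g₂ correct.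
  obtain ⟨τ, h4, h6⟩ := exists_E₆_sq_eq (κ := 121 / 256) (by norm_num) (by norm_num)
  have hπ : (π : ℂ) ≠ 0 := by simp
  push_cast at h6
  obtain ⟨s, hs⟩ := IsAlgClosed.exists_pow_nat_eq (π ^ 4 * E₄ τ / 4) (n := 4) (by norm_num)
  have hs0 : s ≠ 0 := by
    rintro rfl
    have : (π : ℂ) ^ 4 * E₄ τ / 4 ≠ 0 :=
      div_ne_zero (mul_ne_zero (pow_ne_zero _ hπ) h4) (by norm_num)
    exact this (by rw [← hs]; simp)
  have g2 : ∀ (s : ℂ) (hs0 : s ≠ 0), s ^ 4 = π ^ 4 * E₄ τ / 4 →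
      (scaledPeriodPair τ s hs0).g₂ = 16 / 3 := by
    intro s hs0 hs
    rw [PeriodPair.g₂, G_scaledPeriodPair τ s hs0 (k := 4) (by norm_num), hs]
    push_cast
    rw [riemannZeta_four]
    field_simp
    norm_num
  have g3 : ∀ (s : ℂ) (hs0 : s ≠ 0), (scaledPeriodPair τ s hs0).g₃ * s ^ 6 =
      8 * π ^ 6 / 27 * E₆ τ := by
    intro s hs0
    rw [PeriodPair.g₃, G_scaledPeriodPair τ s hs0 (k := 6) (by norm_num)]
    push_cast
    rw [riemannZeta_six]
    field_simp
    ring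
  have hsq : (8 * π ^ 6 / 27 * E₆ τ) ^ 2 = (44 / 27 * s ^ 6) ^ 2 := by
    have : (s ^ 6) ^ 2 = (π ^ 4 * E₄ τ / 4) ^ 3 := by rw [← hs]; ring
    rw [mul_pow (44 / 27), this, mul_pow, h6]
    ring
  -- Now g₃ is right up to sign. Replacing s by i s keeps s⁴, hence g₂, and changes the sign of s⁶,
  -- hence of g₃.
  rcases sq_eq_sq_iff_eq_or_eq_neg.1 hsq with h | h
  · have hI : I * s ≠ 0 := mul_ne_zero I_ne_zero hs0
    refine ⟨scaledPeriodPair τ (I * s) hI, g2 _ _ ?_, ?_⟩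
    · rw [mul_pow, I_pow_four, one_mul, hs]
    · apply mul_right_cancel₀ (pow_ne_zero 6 hI)
      rw [g3, h, mul_pow, show I ^ 6 = (I ^ 2) ^ 3 by ring, I_sq]
      ring
  · refine ⟨scaledPeriodPair τ s hs0, g2 _ _ hs, ?_⟩
    apply mul_right_cancel₀ (pow_ne_zero 6 hs0)
    rw [g3, h]
    ring

end

/-! ### Uniformization of a Weierstrass cubic -/

namespace PeriodPair
open Filter Topology

variable (Λ : PeriodPair)

theorem countable_lattice : (Λ.lattice : Set ℂ).Countable :=
  Set.countable_coe_iff.1 (Λ.latticeEquivProd.toEquiv.countable_iff.2 inferInstance)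

/-- This makes the identity theorem available on the plane with the poles removed. -/
theorem isPreconnected_compl_of_countable {s : Set ℂ} (hs : s.Countable) : IsPreconnected sᶜ :=
  (hs.isConnected_compl_of_one_lt_rank (by simp [Complex.rank_real_complex])).isPreconnected

theorem eventually_notMem_lattice (z₀ : ℂ) : ∀ᶠ z in 𝓝[≠] z₀, z ∉ Λ.lattice := by
  rw [eventually_nhdsWithin_iff]
  filter_upwards [Λ.compl_lattice_sdiff_singleton_mem_nhds z₀] with z hz hne h
  exact hz ⟨h, hne⟩

theorem tendsto_weierstrassP_cobounded {l : ℂ} (hl : l ∈ Λ.lattice) :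
    Tendsto Λ.weierstrassP (𝓝[≠] l) (Bornology.cobounded ℂ) := by
  apply tendsto_cobounded_of_meromorphicOrderAt_neg
  rw [Λ.order_weierstrassP l hl]
  decide

/-- `℘` takes no value on a whole punctured neighbourhood of a point. -/
theorem eventually_weierstrassP_ne (z₀ c : ℂ) : ∀ᶠ z in 𝓝[≠] z₀, Λ.weierstrassP z ≠ c := by
  have hm : MeromorphicAt (fun z => Λ.weierstrassP z - c) z₀ := by
    have := Λ.meromorphic_weierstrassP z₀
    fun_prop
  rcases hm.eventually_eq_zero_or_eventually_ne_zero with h | h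
  · exfalso
    obtain ⟨z₁, h1, h2⟩ := ((eventually_eventually_nhdsWithin.2 h).and
      ((Λ.eventually_notMem_lattice z₀).and self_mem_nhdsWithin)).exists
    have h3 : Λ.weierstrassP =ᶠ[𝓝 z₁] fun _ => c := by
      rw [(isOpen_compl_singleton.nhdsWithin_eq h2.2)] at h1
      exact h1.mono fun z hz => sub_eq_zero.1 hz
    have h4 := Λ.analyticOnNhd_weierstrassP.eqOn_of_preconnected_of_eventuallyEq
      (fun _ _ => analyticAt_const) (isPreconnected_compl_of_countable Λ.countable_lattice) h2.1 h3
    have h5 := Λ.tendsto_weierstrassP_cobounded Λ.lattice.zero_mem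
    have h6 : Tendsto Λ.weierstrassP (𝓝[≠] 0) (𝓝 c) := by
      refine tendsto_const_nhds.congr' ?_
      filter_upwards [Λ.eventually_notMem_lattice 0] with z hz
      exact (h4 hz).symm
    exact h5.not_tendsto (Metric.disjoint_cobounded_nhds c) h6
  · exact h.mono fun z hz => sub_ne_zero.1 hz

/-- `℘` is surjective. -/
theorem exists_weierstrassP_eq (c : ℂ) : ∃ z ∉ Λ.lattice, Λ.weierstrassP z = c := by
  classical
  by_contra! hne
  -- If ℘ omitted c, then 1/(℘ - c), extended by 0 at the poles, would be entire and periodic, hence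
  -- bounded, hence constantly 0 by Liouville, which a reciprocal cannot be.
  let g : ℂ → ℂ := fun z => if z ∈ Λ.lattice then 0 else (Λ.weierstrassP z - c)⁻¹
  have hoff : ∀ z ∉ Λ.lattice, AnalyticAt ℂ g z := by
    intro z hz
    have h1 := Λ.analyticOnNhd_weierstrassP z hz
    have h2 : AnalyticAt ℂ (fun z => (Λ.weierstrassP z - c)⁻¹) z :=
      (h1.sub analyticAt_const).inv (sub_ne_zero.2 (hne z hz))
    refine h2.congr ?_
    filter_upwards [Λ.isClosed_lattice.isOpen_compl.mem_nhds hz] with x hx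
    have : x ∉ Λ.lattice := hx
    simp [g, this]
  have han : ∀ z, AnalyticAt ℂ g z := by
    intro z
    by_cases hz : z ∈ Λ.lattice
    · refine Complex.analyticAt_of_differentiable_on_punctured_nhds_of_continuousAt ?_ ?_
      · filter_upwards [Λ.eventually_notMem_lattice z] with x hx
        exact (hoff x hx).differentiableAt
      · have h1 : Tendsto (fun x => Λ.weierstrassP x - c) (𝓝[≠] z) (Bornology.cobounded ℂ) := by
          rw [← tendsto_norm_atTop_iff_cobounded]
          refine tendsto_atTop_mono (fun x => norm_sub_norm_le _ c) (tendsto_atTop_add_const_right _ _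
            (tendsto_norm_atTop_iff_cobounded.2 (Λ.tendsto_weierstrassP_cobounded hz)))
        rw [continuousAt_iff_punctured_nhds]
        have h2 := tendsto_inv₀_cobounded.comp h1
        have h3 : g z = 0 := by simp [g, hz]
        rw [h3]
        refine h2.congr' ?_
        filter_upwards [Λ.eventually_notMem_lattice z] with x hx
        simp [g, hx]
    · exact hoff z hz
  have hd : Differentiable ℂ g := fun z => (han z).differentiableAt
  have hper : ∀ z w, w ∈ Λ.lattice → g (z + w) = g z := by
    intro z w hw
    have h1 : z + w ∈ Λ.lattice ↔ z ∈ Λ.lattice := Λ.lattice.toAddSubgroup.add_mem_cancel_right hw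
    have h2 := Λ.weierstrassP_add_coe z ⟨w, hw⟩
    simp only [g, h1]
    simp only at h2
    rw [h2]
  have hb := (IsZLattice.isCompact_range_of_periodic Λ.lattice g hd.continuous hper).isBounded
  obtain ⟨z, hz⟩ := (Λ.eventually_notMem_lattice 0).exists
  have h1 := hd.apply_eq_apply_of_bounded hb z 0
  simp only [g, hz, Λ.lattice.zero_mem, if_true, if_false] at h1
  exact inv_ne_zero (sub_ne_zero.2 (hne z hz)) h1

theorem hasDerivAt_weierstrassP {z : ℂ} (hz : z ∉ Λ.lattice) :
    HasDerivAt Λ.weierstrassP (Λ.derivWeierstrassP z) z := by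
  rw [← Λ.deriv_weierstrassP]
  exact (Λ.analyticOnNhd_weierstrassP z hz).differentiableAt.hasDerivAt

/-- `℘'' = 6 ℘² - g₂ / 2`. -/
theorem deriv_derivWeierstrassP {z : ℂ} (hz : z ∉ Λ.lattice) :
    deriv Λ.derivWeierstrassP z = 6 * Λ.weierstrassP z ^ 2 - Λ.g₂ / 2 := by
  have hopen := Λ.isClosed_lattice.isOpen_compl
  have hsq : ∀ x ∉ Λ.lattice, 2 * Λ.derivWeierstrassP x * deriv Λ.derivWeierstrassP x =
      (12 * Λ.weierstrassP x ^ 2 - Λ.g₂) * Λ.derivWeierstrassP x := by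
    intro x hx
    have h1 := (Λ.analyticOnNhd_derivWeierstrassP x hx).differentiableAt.hasDerivAt
    have h2 := Λ.hasDerivAt_weierstrassP hx
    have h3 := h1.fun_pow 2
    have h4 := (((h2.fun_pow 3).const_mul 4).sub (h2.const_mul Λ.g₂)).sub_const Λ.g₃
    have h5 : (fun x => Λ.derivWeierstrassP x ^ 2) =ᶠ[𝓝 x] fun x =>
        4 * Λ.weierstrassP x ^ 3 - Λ.g₂ * Λ.weierstrassP x - Λ.g₃ := by
      filter_upwards [hopen.mem_nhds hx] with y hy
      exact Λ.derivWeierstrassP_sq y hy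
    have h6 := h3.unique (h4.congr_of_eventuallyEq h5)
    push_cast at h6
    linear_combination h6
  -- Differentiating the Weierstrass equation gives the claim multiplied by 2℘'. As ℘ is nowhere
  -- locally constant, ℘' can be cancelled on a punctured neighbourhood, and continuity extends the
  -- result to z.
  have hne : ∀ᶠ x in 𝓝[≠] z, Λ.derivWeierstrassP x ≠ 0 := by
    rcases (Λ.analyticOnNhd_derivWeierstrassP z hz).eventually_eq_zero_or_eventually_ne_zero with
      h | h
    · exfalso
      have h1 : ∀ᶠ x in 𝓝 z, Λ.weierstrassP x = Λ.weierstrassP z := by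
        have hd : ∀ᶠ x in 𝓝 z, deriv Λ.weierstrassP x = 0 := by
          rw [Λ.deriv_weierstrassP]
          exact h
        obtain ⟨ε, hε, hball⟩ := Metric.eventually_nhds_iff_ball.1 (hd.and (hopen.mem_nhds hz))
        filter_upwards [Metric.ball_mem_nhds z hε] with x hx
        refine IsOpen.is_const_of_deriv_eq_zero Metric.isOpen_ball
          (convex_ball z ε).isPreconnected (fun y hy => ?_) (fun y hy => (hball y hy).1) hx
          (Metric.mem_ball_self hε)
        exact (Λ.hasDerivAt_weierstrassP (hball y hy).2).differentiableAt.differentiableWithinAt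
      obtain ⟨x, h2, h3⟩ := ((Λ.eventually_weierstrassP_ne z (Λ.weierstrassP z)).and
        (h1.filter_mono nhdsWithin_le_nhds)).exists
      exact h2 h3
    · exact h
  have hc1 : ContinuousAt (deriv Λ.derivWeierstrassP) z :=
    (Λ.analyticOnNhd_derivWeierstrassP z hz).deriv.continuousAt
  have hc2 : ContinuousAt (fun x => 6 * Λ.weierstrassP x ^ 2 - Λ.g₂ / 2) z := by
    have := (Λ.analyticOnNhd_weierstrassP z hz).continuousAt
    fun_prop
  refine ((hc1.eventuallyEq_nhds_iff_eventuallyEq_nhdsNE hc2).1 ?_).self_of_nhds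
  filter_upwards [hne, Λ.eventually_notMem_lattice z] with x hx hx'
  apply mul_left_cancel₀ hx
  linear_combination hsq x hx' / 2

/-- An analytic solution of `f'' = h f` with vanishing initial values vanishes. -/
theorem _root_.AnalyticAt.eventually_eq_zero_of_deriv_deriv {f h : ℂ → ℂ} {z : ℂ}
    (hf : AnalyticAt ℂ f z) (hh : AnalyticAt ℂ h z) (h0 : f z = 0) (h1 : deriv f z = 0)
    (hode : deriv (deriv f) =ᶠ[𝓝 z] h * f) : ∀ᶠ x in 𝓝 z, f x = 0 := by
  rw [← analyticOrderAt_eq_top]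
  have e1 := hf.analyticOrderAt_deriv_add_one
  have e2 := hf.deriv.analyticOrderAt_deriv_add_one
  -- If f had finite order n at z, then f'' would have order n - 2, whereas h f has order at least
  -- n.
  simp only [h0, h1, sub_zero] at e1 e2
  rw [analyticOrderAt_congr hode, analyticOrderAt_mul hh hf] at e2
  by_contra hne
  obtain ⟨n, hn⟩ := ENat.ne_top_iff_exists.1 hne
  rw [← e2, ← hn] at e1
  have h2 : (n : ℕ∞) + 2 ≤ n := by
    calc (n : ℕ∞) + 2 ≤ analyticOrderAt h z + n + 1 + 1 := by
          rw [add_assoc, one_add_one_eq_two]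
          gcongr
          exact le_add_self
      _ = n := e1
  have h3 : n + 2 ≤ n := by exact_mod_cast h2
  omega

/-- The pair `(℘, ℘')` separates the points of `ℂ / Λ`. -/
theorem sub_mem_lattice_of_weierstrassP_eq {z₁ z₂ : ℂ} (h₁ : z₁ ∉ Λ.lattice) (h₂ : z₂ ∉ Λ.lattice)
    (h : Λ.weierstrassP z₁ = Λ.weierstrassP z₂)
    (h' : Λ.derivWeierstrassP z₁ = Λ.derivWeierstrassP z₂) : z₁ - z₂ ∈ Λ.lattice := by
  set d := z₂ - z₁ with hd
  have hopen := Λ.isClosed_lattice.isOpen_compl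
  have hz₂ : z₁ + d = z₂ := by rw [hd]; ring
  have ht : ∀ z, ContinuousAt (fun z => z + d) z := fun z => by fun_prop
  have hshift : ∀ z, z + d ∉ Λ.lattice → AnalyticAt ℂ (fun z => Λ.weierstrassP (z + d)) z :=
    fun z hz => (Λ.analyticOnNhd_weierstrassP _ hz).comp (f := fun z => z + d) (by fun_prop)
  have hev : ∀ᶠ z in 𝓝 z₁, z ∉ Λ.lattice ∧ z + d ∉ Λ.lattice :=
    (hopen.eventually_mem h₁).and ((ht z₁).eventually (hopen.mem_nhds (by
      change z₁ + d ∉ Λ.lattice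
      rwa [hz₂])))
  have hderiv : ∀ z, z ∉ Λ.lattice → z + d ∉ Λ.lattice →
      HasDerivAt (fun z => Λ.weierstrassP z - Λ.weierstrassP (z + d))
        (Λ.derivWeierstrassP z - Λ.derivWeierstrassP (z + d)) z := fun z hz hz' =>
    (Λ.hasDerivAt_weierstrassP hz).sub ((Λ.hasDerivAt_weierstrassP hz').comp_add_const z d)
  have hderiv2 : ∀ z, z ∉ Λ.lattice → z + d ∉ Λ.lattice →
      HasDerivAt (fun z => Λ.derivWeierstrassP z - Λ.derivWeierstrassP (z + d))
        (deriv Λ.derivWeierstrassP z - deriv Λ.derivWeierstrassP (z + d)) z := fun z hz hz' =>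
    ((Λ.analyticOnNhd_derivWeierstrassP z hz).differentiableAt.hasDerivAt).sub
      (((Λ.analyticOnNhd_derivWeierstrassP _ hz').differentiableAt.hasDerivAt).comp_add_const z d)
  have hd1 : deriv (fun z => Λ.weierstrassP z - Λ.weierstrassP (z + d)) =ᶠ[𝓝 z₁]
      fun z => Λ.derivWeierstrassP z - Λ.derivWeierstrassP (z + d) :=
    hev.mono fun z hz => (hderiv z hz.1 hz.2).deriv
  -- Both ℘(z) and ℘(z+d) solve u'' = 6u² - g₂/2, so their difference f satisfies f'' = 6(℘(z) +
  -- ℘(z+d)) f with zero initial data at z₁.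
  have hzero : ∀ᶠ z in 𝓝 z₁, Λ.weierstrassP z - Λ.weierstrassP (z + d) = 0 := by
    refine AnalyticAt.eventually_eq_zero_of_deriv_deriv
      (h := fun z => 6 * (Λ.weierstrassP z + Λ.weierstrassP (z + d)))
      ((Λ.analyticOnNhd_weierstrassP z₁ h₁).sub (hshift z₁ (by rwa [hz₂])))
      (analyticAt_const.mul ((Λ.analyticOnNhd_weierstrassP z₁ h₁).add
        (hshift z₁ (by rwa [hz₂])))) ?_ ?_ ?_
    · rw [hz₂, h, sub_self]
    · rw [hd1.self_of_nhds]
      simp only [hz₂, h', sub_self]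
    · filter_upwards [hd1.deriv, hev] with z hz hz'
      rw [hz, (hderiv2 z hz'.1 hz'.2).deriv, Λ.deriv_derivWeierstrassP hz'.1,
        Λ.deriv_derivWeierstrassP hz'.2]
      simp only [Pi.mul_apply]
      ring
  by_contra hmem
  have hmem' : d ∉ Λ.lattice := fun hm => hmem (by
    have := Λ.lattice.neg_mem hm
    rwa [hd, neg_sub] at this)
  have hcount : ((Λ.lattice : Set ℂ) ∪ (fun z => z + d) ⁻¹' Λ.lattice).Countable :=
    Λ.countable_lattice.union (Λ.countable_lattice.preimage (add_left_injective d))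
  -- The identity theorem makes d a period of ℘ away from the poles. If d were not in the lattice, ℘
  -- would stay bounded near its pole 0.
  have heq := AnalyticOnNhd.eqOn_of_preconnected_of_eventuallyEq
    (f := Λ.weierstrassP) (g := fun z => Λ.weierstrassP (z + d))
    (U := ((Λ.lattice : Set ℂ) ∪ (fun z => z + d) ⁻¹' Λ.lattice)ᶜ)
    (fun z hz => Λ.analyticOnNhd_weierstrassP z fun hz' => hz (Or.inl hz'))
    (fun z hz => hshift z fun hz' => hz (Or.inr hz'))
    (isPreconnected_compl_of_countable hcount) (z₀ := z₁)
    (by rintro (hm | hm)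
        · exact h₁ hm
        · exact h₂ (hz₂ ▸ hm))
    (hzero.mono fun z hz => sub_eq_zero.1 hz)
  have h5 := Λ.tendsto_weierstrassP_cobounded Λ.lattice.zero_mem
  have h0d : (0 : ℂ) + d ∉ Λ.lattice := by rwa [zero_add]
  have h6 : Tendsto Λ.weierstrassP (𝓝[≠] 0) (𝓝 (Λ.weierstrassP (0 + d))) := by
    refine ((hshift 0 h0d).continuousAt.tendsto.mono_left nhdsWithin_le_nhds).congr' ?_
    filter_upwards [Λ.eventually_notMem_lattice 0,
      ((ht 0).eventually (hopen.mem_nhds h0d)).filter_mono nhdsWithin_le_nhds] with z hz hz'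
    refine (heq ?_).symm
    rintro (hm | hm)
    · exact hz hm
    · exact hz' hm
  exact h5.not_tendsto (Metric.disjoint_cobounded_nhds _) h6

/-- Every point of the Weierstrass cubic is of the form `(℘ z, ℘' z)`. -/
theorem exists_weierstrassP_eq_and_derivWeierstrassP_eq {x y : ℂ}
    (h : y ^ 2 = 4 * x ^ 3 - Λ.g₂ * x - Λ.g₃) :
    ∃ z ∉ Λ.lattice, Λ.weierstrassP z = x ∧ Λ.derivWeierstrassP z = y := by
  obtain ⟨z, hz, rfl⟩ := Λ.exists_weierstrassP_eq x
  rw [← Λ.derivWeierstrassP_sq z hz] at h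
  rcases sq_eq_sq_iff_eq_or_eq_neg.1 h with h | h
  · exact ⟨z, hz, rfl, h.symm⟩
  · exact ⟨-z, fun hm => hz (by simpa using Λ.lattice.neg_mem hm), Λ.weierstrassP_neg z,
      by rw [Λ.derivWeierstrassP_neg, h]⟩

end PeriodPair

/-! ### The elliptic parametrization of the complex curve -/

namespace PeriodPair
open Filter Topology

variable (Λ : PeriodPair)

/-- The first coordinate `X = ℘ - 1/3` on the cubic `Y² = X³ + X² - X`. -/
noncomputable def cubicX (z : ℂ) : ℂ := Λ.weierstrassP z - 1 / 3

/-- The second coordinate `Y = ℘' / 2` on the cubic `Y² = X³ + X² - X`. -/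
noncomputable def cubicY (z : ℂ) : ℂ := Λ.derivWeierstrassP z / 2

/-- Homogeneous coordinates of the point `(X, Y)` on the cubic `cremonaCubic`. -/
noncomputable def cubicVec (z : ℂ) : Fin 3 → ℂ :=
  ![2 * Λ.cubicX z, 1 - Λ.cubicY z, -1 - Λ.cubicY z]

theorem meromorphic_cubicX : Meromorphic Λ.cubicX := by
  have := Λ.meromorphic_weierstrassP
  unfold cubicX
  fun_prop

theorem meromorphic_cubicY : Meromorphic Λ.cubicY := by
  have := Λ.meromorphic_derivWeierstrassP
  unfold cubicY
  fun_prop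

theorem cubicX_add {l : ℂ} (hl : l ∈ Λ.lattice) (z : ℂ) : Λ.cubicX (z + l) = Λ.cubicX z := by
  rw [cubicX, cubicX, Λ.weierstrassP_add_coe z ⟨l, hl⟩]

theorem cubicY_add {l : ℂ} (hl : l ∈ Λ.lattice) (z : ℂ) : Λ.cubicY (z + l) = Λ.cubicY z := by
  rw [cubicY, cubicY, Λ.derivWeierstrassP_add_coe z ⟨l, hl⟩]

theorem isElliptic_of_cubic {f : ℂ → ℂ → ℂ} (h : Meromorphic fun z => f (Λ.cubicX z) (Λ.cubicY z)) :
    IsElliptic Λ fun z => f (Λ.cubicX z) (Λ.cubicY z) :=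
  ⟨h, fun l hl z => by simp only [Λ.cubicX_add hl, Λ.cubicY_add hl]⟩

theorem cubicVec_ne_zero (z : ℂ) : Λ.cubicVec z ≠ 0 := by
  intro h
  have h1 : 1 - Λ.cubicY z = 0 := congrFun h 1
  have h2 : -1 - Λ.cubicY z = 0 := congrFun h 2
  have : (2 : ℂ) = 0 := by linear_combination h1 - h2
  norm_num at this

theorem analyticAt_cremonaVec {v : ℂ → Fin 3 → ℂ} {z : ℂ}
    (hv : ∀ i, AnalyticAt ℂ (fun x => v x i) z) : AnalyticAt ℂ (fun x => cremonaVec (v x)) z := by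
  have h0 := hv 0
  have h1 := hv 1
  have h2 := hv 2
  rw [analyticAt_pi_iff]
  intro i
  fin_cases i <;> simp only [cremonaVec, Fin.zero_eta, Fin.mk_one, Fin.reduceFinMk,
    Matrix.cons_val] <;> fun_prop

theorem eventually_cubicX_ne (z₀ c : ℂ) : ∀ᶠ z in 𝓝[≠] z₀, Λ.cubicX z ≠ c :=
  (Λ.eventually_weierstrassP_ne z₀ (c + 1 / 3)).mono fun _ hz h => hz (eq_add_of_sub_eq h)

section
variable {Λ} (hg₂ : Λ.g₂ = 16 / 3) (hg₃ : Λ.g₃ = -(44 / 27))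
include hg₂ hg₃

/-- The shift by 1/3 and the values of g₂ and g₃ are chosen so that completing the cube in Y² = X³ +
X² - X yields the Weierstrass equation. -/
theorem cubicY_sq {z : ℂ} (hz : z ∉ Λ.lattice) :
    Λ.cubicY z ^ 2 = Λ.cubicX z ^ 3 + Λ.cubicX z ^ 2 - Λ.cubicX z := by
  have h := Λ.derivWeierstrassP_sq z hz
  rw [hg₂, hg₃] at h
  rw [cubicX, cubicY]
  linear_combination h / 4

theorem cremonaCubic_cubicVec {z : ℂ} (hz : z ∉ Λ.lattice) :
    cremonaCubic (Λ.cubicVec z 0) (Λ.cubicVec z 1) (Λ.cubicVec z 2) = 0 := by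
  simp only [cremonaCubic, cubicVec, Matrix.cons_val]
  linear_combination -8 * cubicY_sq hg₂ hg₃ hz

theorem cremonaVec_cubicVec_ne_zero {z : ℂ} (hz : z ∉ Λ.lattice) :
    cremonaVec (Λ.cubicVec z) ≠ 0 :=
  cremonaVec_ne_zero (Λ.cubicVec_ne_zero z) (cremonaCubic_cubicVec hg₂ hg₃ hz)

open Classical in
/-- The map `ℂ → P²(ℂ)` that parametrizes the curve. -/
noncomputable def curveMapLift (z : ℂ) : ProjPlane ℂ :=
  -- At the poles (X, Y) tends to the point [0:1:1] at infinity of the cubic. It lies on the side a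
  -- = 0, which is contracted to [1:0:0].
  if hz : z ∈ Λ.lattice then coordPoint ℂ 0
  else Projectivization.mk ℂ (cremonaVec (Λ.cubicVec z)) (cremonaVec_cubicVec_ne_zero hg₂ hg₃ hz)

theorem curveMapLift_of_mem {z : ℂ} (hz : z ∈ Λ.lattice) :
    curveMapLift hg₂ hg₃ z = coordPoint ℂ 0 := dif_pos hz

theorem curveMapLift_of_notMem {z : ℂ} (hz : z ∉ Λ.lattice) :
    curveMapLift hg₂ hg₃ z = Projectivization.mk ℂ (cremonaVec (Λ.cubicVec z))
      (cremonaVec_cubicVec_ne_zero hg₂ hg₃ hz) := dif_neg hz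

theorem curveMapLift_add {l : ℂ} (hl : l ∈ Λ.lattice) (z : ℂ) :
    curveMapLift hg₂ hg₃ (z + l) = curveMapLift hg₂ hg₃ z := by
  have h1 : z + l ∈ Λ.lattice ↔ z ∈ Λ.lattice := Λ.lattice.toAddSubgroup.add_mem_cancel_right hl
  have h2 : Λ.cubicVec (z + l) = Λ.cubicVec z := by
    simp only [cubicVec, Λ.cubicX_add hl, Λ.cubicY_add hl]
  by_cases hz : z ∈ Λ.lattice
  · rw [curveMapLift_of_mem hg₂ hg₃ hz, curveMapLift_of_mem hg₂ hg₃ (h1.2 hz)]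
  · rw [curveMapLift_of_notMem hg₂ hg₃ hz, curveMapLift_of_notMem hg₂ hg₃ (mt h1.1 hz)]
    simp only [h2]

/-- The map `ℂ / Λ → P²(ℂ)` that parametrizes the curve. -/
noncomputable def curveMap (q : ℂ ⧸ Λ.lattice) : ProjPlane ℂ :=
  curveMapLift hg₂ hg₃ (Function.surjInv Λ.lattice.mkQ_surjective q)

theorem curveMap_mkQ (z : ℂ) : curveMap hg₂ hg₃ (Λ.lattice.mkQ z) = curveMapLift hg₂ hg₃ z := by
  have h := Function.surjInv_eq Λ.lattice.mkQ_surjective (Λ.lattice.mkQ z)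
  rw [curveMap]
  set x := Function.surjInv Λ.lattice.mkQ_surjective (Λ.lattice.mkQ z)
  have h1 : x - z ∈ Λ.lattice := (Submodule.Quotient.eq _).1 h
  have h2 := curveMapLift_add hg₂ hg₃ h1 z
  rwa [add_sub_cancel] at h2

theorem isHolomorphicMap_curveMap : IsHolomorphicMap Λ (curveMap hg₂ hg₃) := by
  intro z₀
  simp only [curveMap_mkQ]
  by_cases hz₀ : z₀ ∈ Λ.lattice
  -- A and B are (z - z₀)³X and (z - z₀)³Y with the principal parts of ℘ and ℘' cleared, so they are
  -- holomorphic at z₀ with values 0 and -1. For z₀ = 0 the term 1/z₀² is 0 by convention, as it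
  -- should be.
  · let A : ℂ → ℂ := fun z =>
      (z - z₀) ^ 3 * (Λ.weierstrassPExcept z₀ z - 1 / z₀ ^ 2 - 1 / 3) + (z - z₀)
    let B : ℂ → ℂ := fun z => (z - z₀) ^ 3 * Λ.derivWeierstrassPExcept z₀ z / 2 - 1
    let V : ℂ → Fin 3 → ℂ := fun z => ![2 * A z, (z - z₀) ^ 3 - B z, -(z - z₀) ^ 3 - B z]
    have hP := Λ.analyticAt_weierstrassPExcept z₀
    have hP' := Λ.analyticAt_derivWeierstrassPExcept z₀
    have hA : AnalyticAt ℂ A z₀ := by fun_prop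
    have hB : AnalyticAt ℂ B z₀ := by fun_prop
    have hV : AnalyticAt ℂ (fun z => cremonaVec (V z)) z₀ := by
      refine analyticAt_cremonaVec fun i => ?_
      fin_cases i <;> simp only [V, Fin.zero_eta, Fin.mk_one, Fin.reduceFinMk,
        Matrix.cons_val] <;> fun_prop
    have hV0 : cremonaVec (V z₀) = Pi.single 0 1 := by
      ext i
      fin_cases i <;> simp [cremonaVec, V, A, B]
    refine ⟨fun z => cremonaVec (V z), hV, ?_⟩
    have hmem := eventually_nhdsWithin_iff.1 (Λ.eventually_notMem_lattice z₀)
    filter_upwards [hmem] with z hz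
    rcases eq_or_ne z z₀ with rfl | hne
    · refine ⟨by rw [hV0]; simp, ?_⟩
      rw [curveMapLift_of_mem hg₂ hg₃ hz₀, coordPoint]
      congr 1
      exact hV0.symm
    · have hz' := hz hne
      have hu : z - z₀ ≠ 0 := sub_ne_zero.2 hne
      have hV' : V z = (z - z₀) ^ 3 • Λ.cubicVec z := by
        have e1 := Λ.weierstrassPExcept_add ⟨z₀, hz₀⟩ z
        have e2 := Λ.derivWeierstrassPExcept_sub ⟨z₀, hz₀⟩ z
        simp only at e1 e2
        have eA : A z = (z - z₀) ^ 3 * Λ.cubicX z := by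
          simp only [A, cubicX, ← e1]
          field_simp
          ring
        have eB : B z = (z - z₀) ^ 3 * Λ.cubicY z := by
          simp only [B, cubicY, ← e2]
          field_simp
        ext i
        fin_cases i <;> simp [V, cubicVec, eA, eB] <;> ring
      have hne0 := cremonaVec_cubicVec_ne_zero hg₂ hg₃ hz'
      have hVc : cremonaVec (V z) = ((z - z₀) ^ 3) ^ 2 • cremonaVec (Λ.cubicVec z) := by
        rw [hV', cremonaVec_smul]
      refine ⟨?_, ?_⟩
      · rw [hVc]
        exact smul_ne_zero (pow_ne_zero _ (pow_ne_zero _ hu)) hne0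
      · rw [curveMapLift_of_notMem hg₂ hg₃ hz', eq_comm, Projectivization.mk_eq_mk_iff']
        exact ⟨_, hVc.symm⟩
  · have hX := Λ.analyticOnNhd_weierstrassP z₀ hz₀
    have hY := Λ.analyticOnNhd_derivWeierstrassP z₀ hz₀
    refine ⟨fun z => cremonaVec (Λ.cubicVec z), analyticAt_cremonaVec fun i => ?_, ?_⟩
    · fin_cases i <;> simp only [cubicVec, cubicX, cubicY, Fin.zero_eta, Fin.mk_one,
        Fin.reduceFinMk, Matrix.cons_val] <;> fun_prop
    · filter_upwards [Λ.isClosed_lattice.isOpen_compl.mem_nhds hz₀] with z hz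
      exact ⟨cremonaVec_cubicVec_ne_zero hg₂ hg₃ hz, curveMapLift_of_notMem hg₂ hg₃ hz⟩

theorem exists_cubicX_eq_and_cubicY_eq {x y : ℂ} (h : y ^ 2 = x ^ 3 + x ^ 2 - x) :
    ∃ z ∉ Λ.lattice, Λ.cubicX z = x ∧ Λ.cubicY z = y := by
  obtain ⟨z, hz, hx, hy⟩ := Λ.exists_weierstrassP_eq_and_derivWeierstrassP_eq
    (x := x + 1 / 3) (y := 2 * y) (by rw [hg₂, hg₃]; linear_combination 4 * h)
  exact ⟨z, hz, by rw [cubicX, hx]; ring, by rw [cubicY, hy]; ring⟩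

/-- The sides a = 0, b = 0, c = 0 meet the cubic, for example, in the point at infinity, in (1,1)
and in (1,-1). -/
theorem coordPoint_mem_range_curveMap (i : Fin 3) :
    coordPoint ℂ i ∈ Set.range (curveMap hg₂ hg₃) := by
  fin_cases i
  · exact ⟨Λ.lattice.mkQ 0, by
      rw [curveMap_mkQ, curveMapLift_of_mem hg₂ hg₃ Λ.lattice.zero_mem]; rfl⟩
  · obtain ⟨z, hz, hx, hy⟩ := exists_cubicX_eq_and_cubicY_eq hg₂ hg₃ (x := 1) (y := 1) (by ring)
    refine ⟨Λ.lattice.mkQ z, ?_⟩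
    rw [curveMap_mkQ, curveMapLift_of_notMem hg₂ hg₃ hz, mk_cremonaVec_eq_coordPoint]
    simp [cubicVec, hy]
  · obtain ⟨z, hz, hx, hy⟩ := exists_cubicX_eq_and_cubicY_eq hg₂ hg₃ (x := 1) (y := -1) (by ring)
    refine ⟨Λ.lattice.mkQ z, ?_⟩
    rw [curveMap_mkQ, curveMapLift_of_notMem hg₂ hg₃ hz, mk_cremonaVec_eq_coordPoint]
    simp [cubicVec, hy]

theorem range_curveMap : Set.range (curveMap hg₂ hg₃) = curveV ℂ := by
  apply Set.Subset.antisymm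
  · rintro _ ⟨q, rfl⟩
    obtain ⟨z, rfl⟩ := Λ.lattice.mkQ_surjective q
    rw [curveMap_mkQ]
    by_cases hz : z ∈ Λ.lattice
    · rw [curveMapLift_of_mem hg₂ hg₃ hz, coordPoint, mk_mem_curveV, eval_sexticQ]
      simp
    · rw [curveMapLift_of_notMem hg₂ hg₃ hz]
      exact mk_cremonaVec_mem_curveV _ (cremonaCubic_cubicVec hg₂ hg₃ hz)
  · intro p
    induction p using Projectivization.ind with | h v hv
    intro hp
    have hQ := (mk_mem_curveV hv).1 hp
    by_cases h0 : v 0 * v 1 * v 2 = 0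
    · rcases (mk_mem_coordPoints hv).2 (mul_eq_zero_of_eval_sexticQ_eq_zero hQ h0) with h | h | h <;>
      · rw [h]
        exact coordPoint_mem_range_curveMap hg₂ hg₃ _
    have hC := cremonaCubic_cremonaVec_eq_zero hQ
    set u := cremonaVec v with hu
    have hu0 : u 0 ≠ 0 := by
      simp only [mul_eq_zero, not_or] at h0
      simp [hu, cremonaVec, h0]
    have hd : u 1 - u 2 ≠ 0 := by
      intro hd
      rw [cremonaCubic, hd] at hC
      exact hu0 (by simpa using hC)
    rw [cremonaCubic] at hC
    obtain ⟨z, hz, hx, hy⟩ := exists_cubicX_eq_and_cubicY_eq hg₂ hg₃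
      (x := u 0 / (u 1 - u 2)) (y := -(u 1 + u 2) / (u 1 - u 2)) (by
        field_simp
        linear_combination -hC)
    refine ⟨Λ.lattice.mkQ z, ?_⟩
    have hvec : Λ.cubicVec z = (2 / (u 1 - u 2)) • u := by
      ext i
      fin_cases i <;> simp [cubicVec, hx, hy] <;> field_simp <;> ring
    rw [curveMap_mkQ, curveMapLift_of_notMem hg₂ hg₃ hz, Projectivization.mk_eq_mk_iff']
    refine ⟨(2 / (u 1 - u 2)) ^ 2 * (v 0 * v 1 * v 2), ?_⟩
    rw [hvec, cremonaVec_smul, hu, cremonaVec_cremonaVec, smul_smul]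

theorem injOn_curveMap :
    Set.InjOn (curveMap hg₂ hg₃) (curveMap hg₂ hg₃ ⁻¹' (curveV ℂ \ singularV ℂ)) := by
  intro q₁ h₁ q₂ h₂ heq
  obtain ⟨z₁, rfl⟩ := Λ.lattice.mkQ_surjective q₁
  obtain ⟨z₂, rfl⟩ := Λ.lattice.mkQ_surjective q₂
  simp only [singularV_eq, Set.mem_preimage, curveMap_mkQ] at h₁ h₂ heq
  have hnot : ∀ z, curveMapLift hg₂ hg₃ z ∈
      curveV ℂ \ {coordPoint ℂ 0, coordPoint ℂ 1, coordPoint ℂ 2} → z ∉ Λ.lattice := by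
    intro z h hz
    exact h.2 (Or.inl (curveMapLift_of_mem hg₂ hg₃ hz))
  have hz₁ := hnot z₁ h₁
  have hz₂ := hnot z₂ h₂
  rw [curveMapLift_of_notMem hg₂ hg₃ hz₁] at heq h₁
  rw [curveMapLift_of_notMem hg₂ hg₃ hz₂] at heq
  simp only [Set.mem_sdiff, Set.mem_insert_iff, Set.mem_singleton_iff, mk_cremonaVec_eq_coordPoint,
    not_or] at h₁
  obtain ⟨r, hr⟩ := exists_smul_eq_of_mk_cremonaVec_eq _ _ heq
    (mul_ne_zero (mul_ne_zero h₁.2.1 h₁.2.2.1) h₁.2.2.2)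
  have e0 : 2 * Λ.cubicX z₁ = r * (2 * Λ.cubicX z₂) := congrFun hr 0
  have e1 : 1 - Λ.cubicY z₁ = r * (1 - Λ.cubicY z₂) := congrFun hr 1
  have e2 : -1 - Λ.cubicY z₁ = r * (-1 - Λ.cubicY z₂) := congrFun hr 2
  -- `cubicVec` is normalized by b - c = 2, which forces the proportionality factor to be 1.
  have hr1 : r = 1 := by linear_combination (e2 - e1) / 2
  rw [hr1, cubicX, cubicX] at e0
  rw [hr1, cubicY, cubicY] at e1
  exact (Submodule.Quotient.eq _).2 (Λ.sub_mem_lattice_of_weierstrassP_eq hz₁ hz₂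
    (by linear_combination e0 / 2) (by linear_combination -2 * e1))

/-- Away from a discrete set, the coordinates avoid the exceptional values. -/
theorem eventually_cubic_generic (z₀ : ℂ) : ∀ᶠ z in 𝓝[≠] z₀, z ∉ Λ.lattice ∧
    Λ.cubicX z - 1 ≠ 0 ∧ Λ.cubicX z + 1 ≠ 0 ∧ Λ.cubicY z - 1 ≠ 0 ∧ Λ.cubicY z + 1 ≠ 0 := by
  filter_upwards [Λ.eventually_notMem_lattice z₀, Λ.eventually_cubicX_ne z₀ 1,
    Λ.eventually_cubicX_ne z₀ (-1)] with z hz h1 h2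
  have h1' := sub_ne_zero.2 h1
  have h2' : Λ.cubicX z + 1 ≠ 0 := fun h => h2 (eq_neg_of_add_eq_zero_left h)
  -- Y² - 1 = X³ + X² - X - 1 = (X+1)²(X-1).
  have h3 : (Λ.cubicY z - 1) * (Λ.cubicY z + 1) ≠ 0 := by
    have : (Λ.cubicY z - 1) * (Λ.cubicY z + 1) = (Λ.cubicX z + 1) ^ 2 * (Λ.cubicX z - 1) := by
      linear_combination cubicY_sq hg₂ hg₃ hz
    rw [this]
    exact mul_ne_zero (pow_ne_zero 2 h2') h1'
  exact ⟨hz, h1', h2', left_ne_zero_of_mul h3, right_ne_zero_of_mul h3⟩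

end

/-! ### The elliptic functions and their relations. -/

/-- The elliptic function `L` of the parametrization. -/
noncomputable def ellipticL (z : ℂ) : ℂ := -2 * Λ.cubicX z / (Λ.cubicY z - 1)

/-- The elliptic function `M` of the parametrization. -/
noncomputable def ellipticM (z : ℂ) : ℂ := -2 * Λ.cubicX z / (Λ.cubicY z + 1)

/-- The elliptic function `ζ` of the parametrization. -/
noncomputable def ellipticζ (z : ℂ) : ℂ := (Λ.cubicX z - 1) / (Λ.cubicX z + 1)

/-- The elliptic function `w` of the parametrization. -/
noncomputable def ellipticw (z : ℂ) : ℂ := 4 * Λ.cubicY z / (Λ.cubicX z + 1) ^ 2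

theorem isElliptic_elliptic : IsElliptic Λ Λ.ellipticL ∧ IsElliptic Λ Λ.ellipticM ∧
    IsElliptic Λ Λ.ellipticζ ∧ IsElliptic Λ Λ.ellipticw := by
  have hX := Λ.meromorphic_cubicX
  have hY := Λ.meromorphic_cubicY
  exact ⟨Λ.isElliptic_of_cubic (f := fun x y => -2 * x / (y - 1)) (by fun_prop),
    Λ.isElliptic_of_cubic (f := fun x y => -2 * x / (y + 1)) (by fun_prop),
    Λ.isElliptic_of_cubic (f := fun x _ => (x - 1) / (x + 1)) (by fun_prop),
    Λ.isElliptic_of_cubic (f := fun x y => 4 * y / (x + 1) ^ 2) (by fun_prop)⟩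

theorem _root_.ContinuousAt.eq_of_eventuallyEq_nhdsNE {f g : ℂ → ℂ} {z : ℂ} (hf : ContinuousAt f z)
    (hg : ContinuousAt g z) (h : ∀ᶠ x in 𝓝[≠] z, f x = g x) : f z = g z :=
  ((hf.eventuallyEq_nhds_iff_eventuallyEq_nhdsNE hg).1 h).self_of_nhds

section
variable {Λ} (hg₂ : Λ.g₂ = 16 / 3) (hg₃ : Λ.g₃ = -(44 / 27))
include hg₂ hg₃

/-- With K = bc, L = ac, M = ab the affine coordinates are L/K = a/b and M/K = a/c. This is a
computation off a discrete set; where `ellipticL` and `ellipticM` are analytic, continuity of both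
sides extends it, so values assigned by division by zero do no harm. -/
theorem curveMap_eq_of_analyticAt {z : ℂ} (hL : AnalyticAt ℂ Λ.ellipticL z)
    (hM : AnalyticAt ℂ Λ.ellipticM z) :
    curveMap hg₂ hg₃ (Λ.lattice.mkQ z) =
      Projectivization.mk ℂ ![1, Λ.ellipticL z, Λ.ellipticM z]
        (fun h => one_ne_zero (congrFun h 0)) := by
  obtain ⟨f, hf, hev⟩ := isHolomorphicMap_curveMap hg₂ hg₃ z
  have hfc : ∀ i, ContinuousAt (fun x => f x i) z := fun i =>
    (continuous_apply i).continuousAt.comp hf.continuousAt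
  have key : ∀ᶠ x in 𝓝[≠] z, f x 1 = Λ.ellipticL x * f x 0 ∧ f x 2 = Λ.ellipticM x * f x 0 := by
    filter_upwards [eventually_cubic_generic hg₂ hg₃ z, hev.filter_mono nhdsWithin_le_nhds] with
      x hx hfx
    obtain ⟨hx, -, -, h1, h2⟩ := hx
    obtain ⟨hfx, he⟩ := hfx
    rw [curveMap_mkQ, curveMapLift_of_notMem hg₂ hg₃ hx, eq_comm,
      Projectivization.mk_eq_mk_iff'] at he
    obtain ⟨r, hr⟩ := he
    rw [← hr]
    simp only [cremonaVec, cubicVec, ellipticL, ellipticM, Pi.smul_apply, smul_eq_mul,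
      Matrix.cons_val]
    constructor
    · field_simp
      ring
    · field_simp
      ring
  have e1 : f z 1 = Λ.ellipticL z * f z 0 :=
    (hfc 1).eq_of_eventuallyEq_nhdsNE (hL.continuousAt.mul (hfc 0)) (key.mono fun _ h => h.1)
  have e2 : f z 2 = Λ.ellipticM z * f z 0 :=
    (hfc 2).eq_of_eventuallyEq_nhdsNE (hM.continuousAt.mul (hfc 0)) (key.mono fun _ h => h.2)
  obtain ⟨hfz, he⟩ := hev.self_of_nhds
  rw [he, Projectivization.mk_eq_mk_iff']
  refine ⟨f z 0, funext fun i => ?_⟩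
  fin_cases i
  · simp
  · simp [e1, mul_comm]
  · simp [e2, mul_comm]

theorem elliptic_relations {z : ℂ} (hL : AnalyticAt ℂ Λ.ellipticL z)
    (hM : AnalyticAt ℂ Λ.ellipticM z) (hζ : AnalyticAt ℂ Λ.ellipticζ z)
    (hw : AnalyticAt ℂ Λ.ellipticw z) :
    let L := Λ.ellipticL z
    let M := Λ.ellipticM z
    let ζ := Λ.ellipticζ z
    let w := Λ.ellipticw z
    ζ ≠ 0 ∧ w ^ 2 = (1 + ζ) * (1 + 3 * ζ - 5 * ζ ^ 2 + ζ ^ 3) ∧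
      L = -((1 + ζ) * (1 - 2 * ζ + ζ ^ 2 + w)) / (4 * ζ) ∧
      M = (1 + ζ) * (1 - 2 * ζ + ζ ^ 2 - w) / (4 * ζ) ∧
      L - M = -((1 + ζ) * (ζ - 1) ^ 2) / (2 * ζ) ∧
      L * M = -((1 + ζ) ^ 2 * (ζ - 1)) / (2 * ζ) := by
  -- Each relation is cleared of the denominator ζ, so that both sides are continuous at z and the
  -- generic identity passes to the limit.
  have key : ∀ᶠ x in 𝓝[≠] z,
      Λ.ellipticw x ^ 2 = (1 + Λ.ellipticζ x) *
        (1 + 3 * Λ.ellipticζ x - 5 * Λ.ellipticζ x ^ 2 + Λ.ellipticζ x ^ 3) ∧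
      4 * Λ.ellipticζ x * Λ.ellipticL x = -((1 + Λ.ellipticζ x) *
        (1 - 2 * Λ.ellipticζ x + Λ.ellipticζ x ^ 2 + Λ.ellipticw x)) ∧
      4 * Λ.ellipticζ x * Λ.ellipticM x = (1 + Λ.ellipticζ x) *
        (1 - 2 * Λ.ellipticζ x + Λ.ellipticζ x ^ 2 - Λ.ellipticw x) ∧
      2 * Λ.ellipticζ x * (Λ.ellipticL x * Λ.ellipticM x) =
        -((1 + Λ.ellipticζ x) ^ 2 * (Λ.ellipticζ x - 1)) := by
    filter_upwards [eventually_cubic_generic hg₂ hg₃ z] with x ⟨hx, h1, h2, h3, h4⟩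
    have hsq := cubicY_sq hg₂ hg₃ hx
    simp only [ellipticL, ellipticM, ellipticζ, ellipticw]
    set X := Λ.cubicX x
    set Y := Λ.cubicY x
    refine ⟨?_, ?_, ?_, ?_⟩
    · field_simp
      linear_combination 16 * hsq
    · field_simp
      linear_combination (8 * X) * hsq
    · field_simp
      linear_combination (8 * X) * hsq
    · field_simp
      linear_combination (-8 * X ^ 2) * hsq
  have cL := hL.continuousAt
  have cM := hM.continuousAt
  have cζ := hζ.continuousAt
  have cw := hw.continuousAt
  have e1 := ContinuousAt.eq_of_eventuallyEq_nhdsNE (by fun_prop) (by fun_prop)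
    (key.mono fun _ h => h.1)
  have e2 := ContinuousAt.eq_of_eventuallyEq_nhdsNE (by fun_prop) (by fun_prop)
    (key.mono fun _ h => h.2.1)
  have e3 := ContinuousAt.eq_of_eventuallyEq_nhdsNE (by fun_prop) (by fun_prop)
    (key.mono fun _ h => h.2.2.1)
  have e4 := ContinuousAt.eq_of_eventuallyEq_nhdsNE (by fun_prop) (by fun_prop)
    (key.mono fun _ h => h.2.2.2)
  intro L M ζ w
  -- At ζ = 0 the product relation 2ζLM = -(1+ζ)²(ζ-1) would read 0 = 1.
  have hne : ζ ≠ 0 := by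
    intro h0
    change 2 * ζ * (L * M) = -((1 + ζ) ^ 2 * (ζ - 1)) at e4
    rw [h0] at e4
    norm_num at e4
  have h4 : (4 : ℂ) * ζ ≠ 0 := mul_ne_zero (by norm_num) hne
  have h2 : (2 : ℂ) * ζ ≠ 0 := mul_ne_zero (by norm_num) hne
  refine ⟨hne, e1, ?_, ?_, ?_, ?_⟩
  · rw [eq_div_iff h4, mul_comm]
    exact e2
  · rw [eq_div_iff h4, mul_comm]
    exact e3
  · rw [eq_div_iff h2]
    linear_combination (e2 - e3) / 2
  · rw [eq_div_iff h2, mul_comm]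
    exact e4

end

end PeriodPair

theorem mainTheorem3 :
    -- `Q` in terms of the elementary symmetric functions of `(K, -L, M)`
    sexticQ ℤ = 4 * gammaSymm ℤ 1 * gammaSymm ℤ 2 * gammaSymm ℤ 3
      - gammaSymm ℤ 2 ^ 3 - 4 * gammaSymm ℤ 3 ^ 2 ∧
    -- the singular points of the complex curve
    singularV ℂ = {coordPoint ℂ 0, coordPoint ℂ 1, coordPoint ℂ 2} ∧
    -- the singular points correspond to the flat metrics
    (∀ (K L M : ℝ) (h : ![K, L, M] ≠ 0),
      Nonempty (SpaceN3 K L M) ∧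
      ∀ N : SpaceN3 K L M, N.IsFlat ↔
        Projectivization.mk ℝ ![K, L, M] h ∈
          ({coordPoint ℝ 0, coordPoint ℝ 1, coordPoint ℝ 2} : Set (ProjPlane ℝ))) ∧
    -- the parametrization of the complex curve by elliptic functions
    (∃ (Γ : PeriodPair) (L M ζ w : ℂ → ℂ) (F : (ℂ ⧸ Γ.lattice) → ProjPlane ℂ),
      IsElliptic Γ L ∧ IsElliptic Γ M ∧ IsElliptic Γ ζ ∧ IsElliptic Γ w ∧
      IsHolomorphicMap Γ F ∧
      (∀ z : ℂ, AnalyticAt ℂ L z → AnalyticAt ℂ M z →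
        F (Γ.lattice.mkQ z) = Projectivization.mk ℂ ![1, L z, M z]
          (fun h => one_ne_zero (congrFun h 0))) ∧
      Set.range F = curveV ℂ ∧
      Set.InjOn F (F ⁻¹' (curveV ℂ \ singularV ℂ)) ∧
      (∀ z : ℂ, AnalyticAt ℂ L z → AnalyticAt ℂ M z → AnalyticAt ℂ ζ z → AnalyticAt ℂ w z →
        ζ z ≠ 0 ∧
        w z ^ 2 = (1 + ζ z) * (1 + 3 * ζ z - 5 * ζ z ^ 2 + ζ z ^ 3) ∧
        L z = -((1 + ζ z) * (1 - 2 * ζ z + ζ z ^ 2 + w z)) / (4 * ζ z) ∧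
        M z = (1 + ζ z) * (1 - 2 * ζ z + ζ z ^ 2 - w z) / (4 * ζ z) ∧
        L z - M z = -((1 + ζ z) * (ζ z - 1) ^ 2) / (2 * ζ z) ∧
        L z * M z = -((1 + ζ z) ^ 2 * (ζ z - 1)) / (2 * ζ z))) ∧
    -- the real points: six arcs joining the three points, two arcs for each pair
    (∃ γ : (j : Fin 3) → Fin 2 → Path (coordPoint ℝ j) (coordPoint ℝ (j + 1)),
      (∀ j s, Function.Injective (γ j s)) ∧
      (∀ j s, ∀ t ∈ Set.Ioo (0 : unitInterval) 1, ∀ i, γ j s t ≠ coordPoint ℝ i) ∧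
      (∀ j s j' s', (j, s) ≠ (j', s') →
        Disjoint (γ j s '' Set.Ioo 0 1) (γ j' s' '' Set.Ioo 0 1)) ∧
      (⋃ j, ⋃ s, Set.range (γ j s)) = curveV ℝ) := by
  obtain ⟨Λ, hg₂, hg₃⟩ := exists_periodPair
  obtain ⟨hL, hM, hζ, hw⟩ := Λ.isElliptic_elliptic
  exact ⟨sexticQ_eq_gammaSymm ℤ, singularV_eq,
    fun K L M h => ⟨nonempty_spaceN3 K L M, fun N => N.isFlat_iff_mem_coordPoints h⟩,
    ⟨Λ, Λ.ellipticL, Λ.ellipticM, Λ.ellipticζ, Λ.ellipticw, PeriodPair.curveMap hg₂ hg₃,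
      hL, hM, hζ, hw, PeriodPair.isHolomorphicMap_curveMap hg₂ hg₃,
      fun _ h₁ h₂ => PeriodPair.curveMap_eq_of_analyticAt hg₂ hg₃ h₁ h₂,
      PeriodPair.range_curveMap hg₂ hg₃, PeriodPair.injOn_curveMap hg₂ hg₃,
      fun _ h₁ h₂ h₃ h₄ => PeriodPair.elliptic_relations hg₂ hg₃ h₁ h₂ h₃ h₄⟩,
    ⟨curveArc, curveArc_injective, fun j s _ ht i => curveArc_ne_coordPoint j s ht i,
      fun _ _ _ _ h => disjoint_curveArc h, iUnion_range_curveArc⟩⟩
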